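/- Let $L$ be a lattice of rank $n$ in a real vector space $V$ of dimension $n$ and let $P\subset V$ be an $n$-dimensional convex polytope with vertices in $L$. For a lattice $M\supseteq L$ in $V$ let $P_M$ be $P$ regarded as a lattice polytope with respect to $M$, and let $E(P_M)\in\mathbb{Q}[t]$ be its Ehrhart polynomial, i.e. the polynomial with $E(P_M)(t)=\#(tP\cap M)$ for all integers $t\ge 0$ (that it exists is Ehrhart's theorem, and is included in the statement for the lattices that occur below); $E(P)=E(P_L)$. Let $c_l(f)$ denote the coefficient of $t^l$ in $f$. For a prime $p$ and $0\le k\le n$ let $$T(p,k)E(P)=\sum_{M}E(P_M),$$ where $M$ runs over the (finitely many) lattices $L\subseteq M\subseteq p^{-1}L$ with $[M:L]=p^k$. For $0\le l\le n$ and an $l$-dimensional subspace $U\subseteq\mathbb{F}_p^n$ put $$\nu_{n,k,l}(p)=\sum_{W\subseteq\mathbb{F}_p^n,\ \dim W=k}p^{\dim (W\cap U)},$$ which does not depend on the choice of $U$. **Theorem 1.** Let $0\le k,l\le n$. 1. For every prime $p$ and every $L$ and $P$ as above, $c_l(T(p,k)E(P))=\nu_{n,k,l}(p)\,c_l(E(P))$.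 2. For every prime $p$, $\nu_{n,k,l}(p)/\nu_{n,n-k,n-l}(p)=p^{k+l-n}$. 3. There is a polynomial $\Phi_{n,k,l}\in\mathbb{Z}[t]$, independent of $p$, all of whose nonzero coefficients are positive, such that $\Phi_{n,k,l}(p)=\nu_{n,k,l}(p)$ for every prime $p$. -/

import Mathlib

open scoped Pointwise

noncomputable section

namespace HeckeEhrhart

variable {V : Type*} [NormedAddCommGroup V] [NormedSpace ℝ V]

/-- `P` is a full-dimensional convex polytope in `V` all of whose vertices lie in `L`. -/
def IsLatticePolytope (L : Submodule ℤ V) (P : Set V) : Prop :=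
  (∃ S : Finset V, (S : Set V) ⊆ (L : Set V) ∧ P = convexHull ℝ (S : Set V)) ∧
    affineSpan ℝ P = ⊤

/-- `f` is the Ehrhart polynomial of `P` with respect to `M`: `f(t) = #(tP ∩ M)` for every
integer `t ≥ 0`. There is at most one such polynomial. -/
def IsEhrhartPolynomial (M : Submodule ℤ V) (P : Set V) (f : Polynomial ℚ) : Prop :=
  ∀ t : ℕ, f.eval (t : ℚ) = (((t : ℝ) • P ∩ (M : Set V)).ncard : ℚ)

theorem IsEhrhartPolynomial.unique {M : Submodule ℤ V} {P : Set V} {f g : Polynomial ℚ}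
    (hf : IsEhrhartPolynomial M P f) (hg : IsEhrhartPolynomial M P g) : f = g := by
  refine Polynomial.eq_of_infinite_eval_eq f g
    ((Set.infinite_range_of_injective (Nat.cast_injective (R := ℚ))).mono ?_)
  rintro _ ⟨t, rfl⟩
  exact (hf t).trans (hg t).symm

open Classical in
/-- The Ehrhart polynomial of `P` with respect to `M` (and `0` if there is none). -/
def ehrhartPolynomial (M : Submodule ℤ V) (P : Set V) : Polynomial ℚ :=
  if h : ∃ f, IsEhrhartPolynomial M P f then h.choose else 0

/-- The superlattice `p⁻¹L = {x | p x ∈ L}` of `L`. -/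
def invSMul (p : ℕ) (L : Submodule ℤ V) : Submodule ℤ V :=
  L.comap (LinearMap.lsmul ℤ V (p : ℤ))

theorem mem_invSMul {p : ℕ} {L : Submodule ℤ V} {x : V} :
    x ∈ invSMul p L ↔ (p : ℤ) • x ∈ L := Iff.rfl

/-- The lattices `M` with `L ⊆ M ⊆ p⁻¹L` and `[M : L] = p ^ k`. -/
def superlattices (p k : ℕ) (L : Submodule ℤ V) : Set (Submodule ℤ V) :=
  {M | L ≤ M ∧ M ≤ invSMul p L ∧ L.toAddSubgroup.relIndex M.toAddSubgroup = p ^ k}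

theorem finite_superlattices [FiniteDimensional ℝ V] (p k : ℕ) [hp : Fact p.Prime]
    (L : Submodule ℤ V) [DiscreteTopology L] : (superlattices p k L).Finite := by
  have hp0 : (p : ℤ) ≠ 0 := by exact_mod_cast hp.out.ne_zero
  have : Module.Finite ℤ L := inferInstance
  have : Module.Finite ℤ (invSMul p L) := by
    let g : invSMul p L →ₗ[ℤ] L :=
      (LinearMap.lsmul ℤ V (p : ℤ)).restrict (fun x hx => mem_invSMul.1 hx)
    refine Module.Finite.of_injective g ?_
    intro x y hxy
    have h : (p : ℤ) • (x : V) = (p : ℤ) • (y : V) := congrArg Subtype.val hxy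
    rw [← Int.cast_smul_eq_zsmul ℝ, ← Int.cast_smul_eq_zsmul ℝ] at h
    exact Subtype.ext (smul_right_injective V (Int.cast_ne_zero.2 hp0) h)
  let Q : Submodule ℤ (V ⧸ L) := (invSMul p L).map L.mkQ
  have : Module.Finite ℤ Q := inferInstance
  have hQ : _root_.Finite Q := by
    refine Module.finite_of_fg_torsion Q ?_
    rintro ⟨_, x, hx, rfl⟩
    refine ⟨⟨(p : ℤ), mem_nonZeroDivisors_of_ne_zero hp0⟩, Subtype.ext ?_⟩
    change (p : ℤ) • L.mkQ x = 0
    rw [← map_smul]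
    exact (Submodule.Quotient.mk_eq_zero L).2 hx
  have hfin : ((Q : Set (V ⧸ L)).powerset).Finite := Set.Finite.powerset (Set.toFinite _)
  refine Set.Finite.of_finite_image (f := fun M : Submodule ℤ V => (M.map L.mkQ : Set (V ⧸ L)))
    (hfin.subset ?_) ?_
  · rintro _ ⟨M, hM, rfl⟩
    exact Submodule.map_mono hM.2.1
  · intro M hM N hN h
    have h' : M.map L.mkQ = N.map L.mkQ := SetLike.coe_injective h
    have := congrArg (Submodule.comap L.mkQ) h'
    rwa [Submodule.comap_map_mkQ, Submodule.comap_map_mkQ, sup_eq_right.2 hM.1,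
      sup_eq_right.2 hN.1] at this

/-- `T(p,k) E(P) = ∑ E(P_M)`, where `M` runs over the superlattices of `L` in `p⁻¹L` of coindex
`p ^ k` and `P_M` is the polytope `P` considered with respect to `M`. -/
def heckeEhrhart [FiniteDimensional ℝ V] (p k : ℕ) [Fact p.Prime]
    (L : Submodule ℤ V) [DiscreteTopology L] (P : Set V) : Polynomial ℚ :=
  ∑ M ∈ (finite_superlattices p k L).toFinset, ehrhartPolynomial M P

/-- `∑ p ^ dim (W ∩ U)` over the `k`-dimensional subspaces `W` of `𝔽_p ^ n`, for a given
subspace `U`. -/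
def nu {p : ℕ} [Fact p.Prime] {n : ℕ} (k : ℕ) (U : Submodule (ZMod p) (Fin n → ZMod p)) : ℕ :=
  ∑ W ∈ (Set.toFinite {W : Submodule (ZMod p) (Fin n → ZMod p) |
      Module.finrank (ZMod p) W = k}).toFinset,
    p ^ Module.finrank (ZMod p) (W ⊓ U : Submodule (ZMod p) (Fin n → ZMod p))

end HeckeEhrhart

end

/-!
# Hecke operators acting on Ehrhart polynomials

The sum `∑ M, #(tP ∩ M)` over the superlattices `M` counts every point `x` of `tP ∩ p⁻¹L` as often
as there are `M` containing `x`. Since `p⁻¹L / L` is an `n`-dimensional vector space over `𝔽_p` and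
the `M` correspond to its `k`-dimensional subspaces `W`, this multiplicity is the number `N₀` of all
`W` when `x ∈ L`, and otherwise the number `N₁` of those `W` that contain a fixed nonzero vector.
As `tP ∩ p⁻¹L` is in bijection with `ptP ∩ L`, it follows that
`T(p,k)E(P)(t) = N₁ E(P)(pt) + (N₀ - N₁) E(P)(t)` (`heckeEhrhart_eq`), so that `c_l` is multiplied
by `N₀ + (p ^ l - 1) N₁`. Double counting the pairs `u ∈ W ∩ U` gives the same value for `ν_{n,k,l}(p)`
(`sum_card_pow_finrank_inf`, `nu_eq`).

The numbers `N₀` and `N₁` are Gaussian binomial coefficients (`ncard_setOf_finrank_eq`), and their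
Pascal recursion turns `ν_{n,k,l}` into `p ^ l [n-1, k-1] + p ^ k [n-1, k]`, a polynomial in `p`
without negative coefficients (`aeval_nuPolynomial`). The functional equation is the duality
`W ↦ Wᗮ` (`nu_mul_pow_eq`).

The geometric input is Ehrhart's theorem (`exists_isEhrhartPolynomial`), which has to hold for every
`t ≥ 0`, including `t = 0`. In place of a triangulation, the indicator function of the cone over `P`
is written as an integral combination of indicator functions of simplicial cones other than `{0}`
(`indicator_cone_mem_simplicialSpan`). This is an induction on the number of generators: a linear
relation between indicator functions of cones persists when a ray is added to each of them, by the
additivity of the Euler characteristic of compact intervals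
(`sum_nonempty_eq_zero_of_sum_indicator_eq_zero`), and adding a ray to a simplicial cone creates at
most one linear dependency, for which inclusion-exclusion is explicit
(`sum_powerset_indicator_cone_sdiff_eq_zero`). In a simplicial cone with generators of height one
the lattice points are counted with the half open parallelepiped
(`exists_polynomial_ncard_simplicial`).
-/

open scoped Pointwise

noncomputable section

namespace HeckeEhrhart

/-! ### Euler characteristic of compact intervals -/

/-- Evaluating the Euler characteristic on a linear relation between the indicator functions of
compact intervals. At each point `x`, the intervals with right end `x` are those that contain `x`
but no point slightly to the right of `x`. -/
theorem sum_nonempty_eq_zero_of_sum_indicator_eq_zero {ι : Type*} [Fintype ι] (c : ι → ℤ)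
    (I : ι → Set ℝ) (hcomp : ∀ i, IsCompact (I i)) (hconn : ∀ i, (I i).OrdConnected)
    (h : ∀ a, ∑ i, c i * (I i).indicator 1 a = 0) :
    (∑ i, c i * {i | (I i).Nonempty}.indicator 1 i : ℤ) = 0 := by
  classical
  have key : ∀ x : ℝ, ∑ i, (if x ∈ I i ∧ x = sSup (I i) then c i else 0) = 0 := by
    intro x
    have hev : ∀ᶠ y in nhdsWithin x (Set.Ioi x), ∀ i, (y ∈ I i ↔ x ∈ I i ∧ x ≠ sSup (I i)) := by
      refine Filter.eventually_all.2 fun i => ?_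
      by_cases hx : x ∈ I i
      · have hmem : sSup (I i) ∈ I i := (hcomp i).sSup_mem ⟨x, hx⟩
        have hle : x ≤ sSup (I i) := le_csSup (hcomp i).bddAbove hx
        rcases hle.eq_or_lt with heq | hlt
        · filter_upwards [self_mem_nhdsWithin] with y hy
          have : y ∉ I i := fun hyI =>
            absurd (le_csSup (hcomp i).bddAbove hyI) (not_le.2 (heq ▸ hy))
          simp [this, ← heq]
        · filter_upwards [Ioo_mem_nhdsGT hlt] with y hy
          have : y ∈ I i := (hconn i).out hx hmem ⟨hy.1.le, hy.2.le⟩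
          simp [this, hx, hlt.ne]
      · filter_upwards [nhdsWithin_le_nhds ((hcomp i).isClosed.isOpen_compl.mem_nhds hx)] with y hy
        simp only [hx, false_and, iff_false]
        exact hy
    obtain ⟨y, hy⟩ := hev.exists
    have h1 := h x
    have h2 := h y
    refine Eq.trans ?_ ((congrArg₂ (· - ·) h1 h2).trans (sub_zero 0))
    simp only [← Finset.sum_sub_distrib]
    refine Finset.sum_congr rfl fun i _ => ?_
    simp only [Set.indicator_apply, hy i, Pi.one_apply]
    by_cases hx : x ∈ I i <;> by_cases hx' : x = sSup (I i) <;> simp [hx, hx']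
  have hsum : (∑ i, c i * {i | (I i).Nonempty}.indicator 1 i : ℤ) =
      ∑ x ∈ Finset.univ.image (fun i => sSup (I i)),
        ∑ i, (if x ∈ I i ∧ x = sSup (I i) then c i else 0) := by
    rw [Finset.sum_comm]
    refine Finset.sum_congr rfl fun i _ => ?_
    rw [Finset.sum_eq_single (sSup (I i))]
    · by_cases hne : (I i).Nonempty
      · simp [hne, (hcomp i).sSup_mem hne]
      · simp [Set.not_nonempty_iff_eq_empty.1 hne]
    · intro x _ hx
      simp [hx]
    · intro hx
      exact absurd (Finset.mem_image_of_mem _ (Finset.mem_univ i)) hx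
  rw [hsum]
  exact Finset.sum_eq_zero fun x _ => key x

/-! ### Finitely generated cones -/

/-- The closed convex cone spanned by a finite set. -/
def cone {W : Type*} [AddCommGroup W] [Module ℝ W] (T : Finset W) : Set W :=
  {x | ∃ μ : W → ℝ, (∀ s ∈ T, 0 ≤ μ s) ∧ ∑ s ∈ T, μ s • s = x}

section Cone

variable {W : Type*} [AddCommGroup W] [Module ℝ W]

theorem cone_mono {S T : Finset W} (h : S ⊆ T) : cone S ⊆ cone T := by
  classical
  rintro x ⟨μ, hμ, rfl⟩
  refine ⟨fun s => if s ∈ S then μ s else 0, fun s _ => ?_, ?_⟩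
  · by_cases hs : s ∈ S <;> simp [hs, hμ]
  · rw [← Finset.sum_subset h (f := fun s => (if s ∈ S then μ s else 0) • s)]
    · exact Finset.sum_congr rfl fun s hs => by simp [hs]
    · intro s _ hs
      simp [hs]

theorem mem_cone_insert [DecidableEq W] {T : Finset W} {v x : W} :
    x ∈ cone (insert v T) ↔ ∃ a : ℝ, 0 ≤ a ∧ x - a • v ∈ cone T := by
  constructor
  · rintro ⟨μ, hμ, rfl⟩
    by_cases hv : v ∈ T
    · rw [Finset.insert_eq_of_mem hv] at hμ ⊢
      exact ⟨0, le_rfl, μ, hμ, by simp⟩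
    · refine ⟨μ v, hμ v (Finset.mem_insert_self v T), μ,
        fun s hs => hμ s (Finset.mem_insert_of_mem hs), ?_⟩
      rw [Finset.sum_insert hv, add_sub_cancel_left]
  · rintro ⟨a, ha, μ, hμ, h⟩
    by_cases hv : v ∈ T
    · rw [Finset.insert_eq_of_mem hv]
      refine ⟨fun s => μ s + if s = v then a else 0, fun s hs => ?_, ?_⟩
      · have := hμ s hs
        dsimp only
        split_ifs <;> linarith
      · simp only [add_smul, Finset.sum_add_distrib, h, ite_smul, zero_smul]
        rw [Finset.sum_ite_eq' T v]
        simp [hv]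
    · refine ⟨Function.update μ v a, fun s hs => ?_, ?_⟩
      · rcases Finset.mem_insert.1 hs with rfl | hs
        · simpa using ha
        · rw [Function.update_of_ne (ne_of_mem_of_not_mem hs hv)]
          exact hμ s hs
      · rw [Finset.sum_insert hv, Function.update_self,
          Finset.sum_congr rfl fun s hs => by
            rw [Function.update_of_ne (ne_of_mem_of_not_mem hs hv)], h]
        simp

/-- Inclusion-exclusion for a cone over a set `S` with a single linear dependency `lam`: the facets
`cone (S \ {s})` with `lam s > 0` cover the cone, and they intersect as the sets `S \ {s}` do. -/
theorem sum_powerset_indicator_cone_sdiff_eq_zero [DecidableEq W] (S : Finset W) (lam : W → ℝ)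
    (hlam : ∑ s ∈ S, lam s • s = 0)
    (huniq : ∀ ρ : W → ℝ, ∑ s ∈ S, ρ s • s = 0 → ∃ q, ∀ s ∈ S, ρ s = q * lam s)
    (hpos : ∃ s ∈ S, 0 < lam s) (x : W) :
    ∑ R ∈ ({s ∈ S | 0 < lam s} : Finset W).powerset,
      (-1) ^ R.card * (cone (S \ R)).indicator (1 : W → ℤ) x = 0 := by
  set Sp : Finset W := {s ∈ S | 0 < lam s} with hSp
  by_cases hx : x ∈ cone S
  swap
  · refine Finset.sum_eq_zero fun R _ => ?_
    rw [Set.indicator_of_notMem fun h => hx (cone_mono Finset.sdiff_subset h), mul_zero]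
  obtain ⟨μ, hμ, hμx⟩ := hx
  have hSpne : Sp.Nonempty := by
    obtain ⟨s, hs, h⟩ := hpos
    exact ⟨s, Finset.mem_filter.2 ⟨hs, h⟩⟩
  -- Move along the dependency until the first coordinate indexed by `Sp` vanishes.
  obtain ⟨z, hz, hmin⟩ := Finset.exists_min_image Sp (fun s => μ s / lam s) hSpne
  have hzS := (Finset.mem_filter.1 hz).1
  have hzpos := (Finset.mem_filter.1 hz).2
  set r := μ z / lam z with hr
  have hr0 : 0 ≤ r := div_nonneg (hμ z hzS) hzpos.le
  set μ' : W → ℝ := fun s => μ s - r * lam s with hμ'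
  have hμ'0 : ∀ s ∈ S, 0 ≤ μ' s := by
    intro s hs
    by_cases hsp : 0 < lam s
    · have := hmin s (Finset.mem_filter.2 ⟨hs, hsp⟩)
      rw [le_div_iff₀ hsp] at this
      simp only [hμ']; linarith
    · have : r * lam s ≤ 0 := mul_nonpos_of_nonneg_of_nonpos hr0 (not_lt.1 hsp)
      have := hμ s hs
      simp only [hμ']; linarith
  have hμ'x : ∑ s ∈ S, μ' s • s = x := by
    simp only [hμ', sub_smul, mul_smul, Finset.sum_sub_distrib, ← Finset.smul_sum, hlam, hμx]
    simp
  have hμ'z : μ' z = 0 := by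
    simp only [hμ', hr]; field_simp; ring
  set Z : Finset W := {s ∈ Sp | μ' s = 0} with hZ
  have hmem : ∀ R ⊆ Sp, (x ∈ cone (S \ R) ↔ R ⊆ Z) := by
    intro R hR
    constructor
    -- A representation of `x` is `μ' + q • lam` for some `q`, and `0 ≤ q` since `μ' z = 0`.
    · rintro ⟨ρ, hρ, hρx⟩ s hs
      obtain ⟨q, hq⟩ := huniq (fun s => (if s ∈ R then 0 else ρ s) - μ' s) (by
        simp only [sub_smul, Finset.sum_sub_distrib, hμ'x, ite_smul, zero_smul]
        rw [sub_eq_zero, ← hρx, Finset.sum_ite, Finset.sum_const_zero, zero_add,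
          Finset.sdiff_eq_filter])
      have hq0 : 0 ≤ q := by
        have h1 := hq z hzS
        have h2 : (0 : ℝ) ≤ if z ∈ R then 0 else ρ z := by
          split_ifs with h
          · exact le_rfl
          · exact hρ z (Finset.mem_sdiff.2 ⟨hzS, h⟩)
        rw [hμ'z, sub_zero] at h1
        rw [h1] at h2
        exact nonneg_of_mul_nonneg_left h2 hzpos
      have hsSp := Finset.mem_filter.1 (hR hs)
      have h1 := hq s hsSp.1
      simp only [hs, if_true] at h1
      have h2 := hμ'0 s hsSp.1
      have h3 : 0 ≤ q * lam s := mul_nonneg hq0 hsSp.2.le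
      exact Finset.mem_filter.2 ⟨hR hs, by linarith⟩
    · intro hRZ
      refine ⟨μ', fun s hs => hμ'0 s (Finset.mem_sdiff.1 hs).1, ?_⟩
      rw [← hμ'x]
      refine Finset.sum_subset Finset.sdiff_subset fun s hs hs' => ?_
      have : s ∈ R := by
        by_contra h
        exact hs' (Finset.mem_sdiff.2 ⟨hs, h⟩)
      rw [(Finset.mem_filter.1 (hRZ this)).2, zero_smul]
  have hZSp : Z ⊆ Sp := Finset.filter_subset _ _
  have hZne : Z.Nonempty := ⟨z, Finset.mem_filter.2 ⟨hz, hμ'z⟩⟩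
  rw [← Finset.sum_powerset_neg_one_pow_card_of_nonempty hZne]
  symm
  rw [← Finset.sum_subset (Finset.powerset_mono.2 hZSp)]
  · refine Finset.sum_congr rfl fun R hR => ?_
    rw [Finset.mem_powerset] at hR
    rw [Set.indicator_of_mem ((hmem R (hR.trans hZSp)).2 hR)]
    simp
  · intro R hR hR'
    rw [Finset.mem_powerset] at hR hR'
    rw [Set.indicator_of_notMem fun h => hR' ((hmem R hR).1 h), mul_zero]

end Cone

/-! ### Decomposition of cones into simplicial cones -/

section ConeDecomposition

variable {W : Type*} [NormedAddCommGroup W] [NormedSpace ℝ W]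

theorem isCompact_setOf_sub_smul_mem_cone (ht : W →ₗ[ℝ] ℝ) {T : Finset W} {v : W}
    (hT : ∀ s ∈ T, ht s = 1) (hv : ht v = 1) (x : W) :
    IsCompact {a : ℝ | 0 ≤ a ∧ x - a • v ∈ cone T} := by
  classical
  let K : Set ((T → ℝ) × ℝ) := {q | (0 ≤ q.1 ∧ 0 ≤ q.2) ∧ ∑ s, q.1 s • (s : W) + q.2 • v = x}
  have hK : IsCompact K := by
    refine (isCompact_Icc (a := ((0 : T → ℝ), (0 : ℝ)))
      (b := ((fun _ => ht x : T → ℝ), ht x))).of_isClosed_subset ?_ ?_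
    · refine IsClosed.inter ?_ ?_
      · exact (isClosed_le continuous_const continuous_fst).inter
          (isClosed_le continuous_const continuous_snd)
      · exact isClosed_eq (by fun_prop) continuous_const
    · rintro ⟨μ, a⟩ ⟨⟨hμ, ha⟩, h⟩
      dsimp only at hμ ha h
      have hsum : ∑ s, μ s + a = ht x := by
        rw [← h, map_add, map_sum, map_smul, hv]
        simp [hT]
      refine ⟨⟨hμ, ha⟩, fun s => ?_, ?_⟩
      · have := Finset.single_le_sum (f := μ) (fun i _ => hμ i) (Finset.mem_univ s)
        dsimp only
        linarith
      · have : 0 ≤ ∑ s, μ s := Finset.sum_nonneg fun i _ => hμ i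
        dsimp only
        linarith
  convert! hK.image continuous_snd using 1
  ext a
  constructor
  · rintro ⟨ha, μ, hμ, h⟩
    refine ⟨(fun s => μ s, a), ⟨⟨fun s => hμ s s.2, ha⟩, ?_⟩, rfl⟩
    dsimp only
    rw [Finset.sum_coe_sort T (fun s => μ s • s), h]
    simp
  · rintro ⟨⟨μ, b⟩, ⟨⟨hμ, ha⟩, h⟩, rfl⟩
    refine ⟨ha, fun s => if hs : s ∈ T then μ ⟨s, hs⟩ else 0, fun s hs => ?_, ?_⟩
    · simpa [hs] using hμ ⟨s, hs⟩
    · dsimp only at h ⊢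
      rw [← h, ← Finset.sum_coe_sort T]
      simp

theorem convex_cone (T : Finset W) : Convex ℝ (cone T) := by
  rintro x ⟨μ, hμ, rfl⟩ y ⟨ν, hν, rfl⟩ a b ha hb _
  refine ⟨fun s => a * μ s + b * ν s,
    fun s hs => add_nonneg (mul_nonneg ha (hμ s hs)) (mul_nonneg hb (hν s hs)), ?_⟩
  simp [add_smul, mul_smul, Finset.sum_add_distrib, Finset.smul_sum]

/-- A linear relation between indicator functions of cones persists when the same ray is added to
all of them: on each line parallel to the ray the cones cut out compact intervals. -/
theorem sum_indicator_cone_insert_eq_zero [DecidableEq W] {ι : Type*} [Fintype ι]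
    (ht : W →ₗ[ℝ] ℝ) (c : ι → ℤ) (T : ι → Finset W) {v : W} (hT : ∀ i, ∀ s ∈ T i, ht s = 1)
    (hv : ht v = 1) (h : ∀ x, ∑ i, c i * (cone (T i)).indicator (1 : W → ℤ) x = 0) (x : W) :
    ∑ i, c i * (cone (insert v (T i))).indicator (1 : W → ℤ) x = 0 := by
  have := sum_nonempty_eq_zero_of_sum_indicator_eq_zero c
    (fun i => {a : ℝ | 0 ≤ a ∧ x - a • v ∈ cone (T i)})
    (fun i => isCompact_setOf_sub_smul_mem_cone ht (hT i) hv x) ?_ ?_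
  · rw [← this]
    refine Finset.sum_congr rfl fun i _ => ?_
    congr 1
    classical
    rw [Set.indicator_apply, Set.indicator_apply]
    exact if_congr mem_cone_insert rfl rfl
  · intro i
    have hconv : Convex ℝ {a : ℝ | 0 ≤ a ∧ x - a • v ∈ cone (T i)} := by
      refine (convex_Ici (0 : ℝ)).inter ?_
      refine (convex_cone (T i)).affine_preimage
        ((AffineMap.const ℝ ℝ x) - (LinearMap.toSpanSingleton ℝ W v).toAffineMap)
    exact hconv.ordConnected
  · intro a
    by_cases ha : 0 ≤ a
    · rw [← h (x - a • v)]
      refine Finset.sum_congr rfl fun i _ => ?_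
      classical
      rw [Set.indicator_apply, Set.indicator_apply]
      exact congrArg _ (if_congr (and_iff_right ha) rfl rfl)
    · exact Finset.sum_eq_zero fun i _ => by simp [ha]

/-- The integral span of the indicator functions of the simplicial cones with generators in `S`.
The trivial cone `{0}` is left out: its number of lattice points of height `t` is `1` for `t = 0`
and `0` for `t > 0`, which is not polynomial. -/
def simplicialSpan (S : Finset W) : Submodule ℤ (W → ℤ) :=
  Submodule.span ℤ ((fun T : Finset W => (cone T).indicator (1 : W → ℤ)) ''
    {T | T ⊆ S ∧ T.Nonempty ∧ LinearIndepOn ℝ id (T : Set W)})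

theorem simplicialSpan_mono {S T : Finset W} (h : S ⊆ T) :
    simplicialSpan S ≤ simplicialSpan T :=
  Submodule.span_mono (Set.image_mono fun _ hR => ⟨hR.1.trans h, hR.2⟩)

theorem linearIndepOn_finset_iff_forall {T : Finset W} :
    LinearIndepOn ℝ id (T : Set W) ↔
      ∀ ρ : W → ℝ, ∑ s ∈ T, ρ s • s = 0 → ∀ s ∈ T, ρ s = 0 := by
  rw [linearIndepOn_finset_iff]
  rfl

/-- The case of a minimal step: `T` is independent and `insert v T` carries at most one linear
dependency. -/
theorem indicator_cone_insert_mem_simplicialSpan [DecidableEq W] (ht : W →ₗ[ℝ] ℝ)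
    {T : Finset W} {v : W} (hT : ∀ s ∈ T, ht s = 1) (hv : ht v = 1)
    (hli : LinearIndepOn ℝ id (T : Set W)) :
    (cone (insert v T)).indicator (1 : W → ℤ) ∈ simplicialSpan (insert v T) := by
  by_cases hins : LinearIndepOn ℝ id ((insert v T : Finset W) : Set W)
  · exact Submodule.subset_span ⟨_, ⟨subset_rfl, Finset.insert_nonempty v T, hins⟩, rfl⟩
  have hvT : v ∉ T := fun h => hins (by rwa [Finset.insert_eq_of_mem h])
  set S := insert v T with hS
  have hS1 : ∀ s ∈ S, ht s = 1 := by
    intro s hs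
    rcases Finset.mem_insert.1 hs with rfl | hs
    exacts [hv, hT s hs]
  rw [linearIndepOn_finset_iff_forall] at hins hli
  push Not at hins
  obtain ⟨lam, hlam, s₀, hs₀, hs₀0⟩ := hins
  have hlamv : lam v ≠ 0 := by
    intro h0
    rw [hS, Finset.sum_insert hvT, h0, zero_smul, zero_add] at hlam
    rcases Finset.mem_insert.1 hs₀ with rfl | hs
    · exact hs₀0 h0
    · exact hs₀0 (hli lam hlam s₀ hs)
  have huniq : ∀ ρ : W → ℝ, ∑ s ∈ S, ρ s • s = 0 → ∃ q, ∀ s ∈ S, ρ s = q * lam s := by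
    intro ρ hρ
    refine ⟨ρ v / lam v, ?_⟩
    have hd : ∑ s ∈ S, (ρ s - ρ v / lam v * lam s) • s = 0 := by
      simp only [sub_smul, mul_smul, Finset.sum_sub_distrib, hρ, ← Finset.smul_sum, hlam]
      simp
    have hv0 : ρ v - ρ v / lam v * lam v = 0 := by field_simp; ring
    rw [hS, Finset.sum_insert hvT, hv0, zero_smul, zero_add] at hd
    intro s hs
    rcases Finset.mem_insert.1 hs with rfl | hs
    · linarith
    · have := hli _ hd s hs
      linarith
  have hsum : ∑ s ∈ S, lam s = 0 := by
    have := congrArg ht hlam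
    rw [map_sum, map_zero] at this
    rw [← this]
    exact Finset.sum_congr rfl fun s hs => by rw [map_smul, hS1 s hs, smul_eq_mul, mul_one]
  have hpos : ∃ s ∈ S, 0 < lam s := Finset.exists_pos_of_sum_zero_of_exists_nonzero lam hsum
    ⟨s₀, hs₀, hs₀0⟩
  obtain ⟨m, hmS, hm⟩ : ∃ s ∈ S, lam s < 0 := by
    by_contra! hall
    exact hs₀0 ((Finset.sum_eq_zero_iff_of_nonneg hall).1 hsum s₀ hs₀)
  set Sp : Finset W := {s ∈ S | 0 < lam s} with hSp
  have hie := sum_powerset_indicator_cone_sdiff_eq_zero S lam hlam huniq hpos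
  have heq : (cone S).indicator (1 : W → ℤ) =
      - ∑ R ∈ Sp.powerset.erase ∅, ((-1 : ℤ) ^ R.card) • (cone (S \ R)).indicator (1 : W → ℤ) := by
    funext x
    have := hie x
    rw [← Finset.add_sum_erase _ _ (Finset.empty_mem_powerset Sp)] at this
    simp only [Finset.card_empty, pow_zero, one_mul, Finset.sdiff_empty] at this
    simp only [Pi.neg_apply, Finset.sum_apply, Pi.smul_apply, smul_eq_mul]
    linarith
  rw [heq]
  refine Submodule.neg_mem _ (Submodule.sum_mem _ fun R hR => Submodule.smul_mem _ _ ?_)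
  obtain ⟨hRne, hR⟩ := Finset.mem_erase.1 hR
  rw [Finset.mem_powerset] at hR
  refine Submodule.subset_span ⟨S \ R, ⟨Finset.sdiff_subset, ⟨m, ?_⟩, ?_⟩, rfl⟩
  · exact Finset.mem_sdiff.2 ⟨hmS, fun h => (Finset.mem_filter.1 (hR h)).2.not_gt hm⟩
  · rw [linearIndepOn_finset_iff_forall]
    intro ρ hρ s hs
    obtain ⟨q, hq⟩ := huniq (fun s => if s ∈ R then 0 else ρ s) (by
      rw [← hρ, Finset.sdiff_eq_filter, Finset.sum_filter]
      exact Finset.sum_congr rfl fun s _ => by by_cases h : s ∈ R <;> simp [h])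
    obtain ⟨w, hw⟩ := Finset.nonempty_iff_ne_empty.2 hRne
    have hwS := Finset.mem_filter.1 (hR hw)
    have h1 := hq w hwS.1
    simp only [hw, if_true] at h1
    have hq0 : q = 0 := (mul_eq_zero.1 h1.symm).resolve_right hwS.2.ne'
    have h2 := hq s (Finset.mem_sdiff.1 hs).1
    simpa [(Finset.mem_sdiff.1 hs).2, hq0] using h2

/-- Signed decomposition of a finitely generated cone into simplicial cones, without using the
trivial cone. -/
theorem indicator_cone_mem_simplicialSpan (ht : W →ₗ[ℝ] ℝ) {S : Finset W} (hne : S.Nonempty)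
    (hS : ∀ s ∈ S, ht s = 1) :
    (cone S).indicator (1 : W → ℤ) ∈ simplicialSpan S := by
  classical
  induction hne using Finset.Nonempty.cons_induction with
  | singleton v =>
    refine Submodule.subset_span ⟨{v}, ⟨subset_rfl, Finset.singleton_nonempty v, ?_⟩, rfl⟩
    rw [Finset.coe_singleton]
    refine LinearIndepOn.singleton fun h0 : v = 0 => ?_
    have := hS v (Finset.mem_singleton_self v)
    rw [h0, map_zero] at this
    exact zero_ne_one this
  | cons v S hv hne ih =>
    rw [Finset.cons_eq_insert] at hS ⊢
    have hS' : ∀ s ∈ S, ht s = 1 := fun s hs => hS s (Finset.mem_insert_of_mem hs)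
    have hv1 : ht v = 1 := hS v (Finset.mem_insert_self v S)
    obtain ⟨n, c, g, hg⟩ := Submodule.mem_span_set'.1 (ih hS')
    choose T hT hTg using fun i => (g i).2
    -- The decomposition of `cone S`, as a relation indexed by the simplicial cones and `cone S`.
    have hrel : ∀ x, ∑ i : Option (Fin n), (i.elim (-1) c : ℤ) *
        (cone (i.elim S T)).indicator (1 : W → ℤ) x = 0 := by
      intro x
      rw [Fintype.sum_option]
      have := congrFun hg x
      simp only [Finset.sum_apply, Pi.smul_apply, smul_eq_mul] at this
      simp only [Option.elim_none, Option.elim_some]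
      rw [← this, neg_one_mul, neg_add_eq_zero]
      exact Finset.sum_congr rfl fun i _ => by rw [← hTg i]
    have hrel' := sum_indicator_cone_insert_eq_zero ht (fun i : Option (Fin n) => i.elim (-1) c)
      (fun i => i.elim S T) (v := v) (by
        rintro (_ | i) s hs
        · exact hS' s hs
        · exact hS' s ((hT i).1 hs)) hv1 hrel
    have heq : (cone (insert v S)).indicator (1 : W → ℤ) =
        ∑ i, c i • (cone (insert v (T i))).indicator (1 : W → ℤ) := by
      funext x
      have := hrel' x
      rw [Fintype.sum_option] at this
      simp only [Option.elim_none, Option.elim_some] at this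
      simp only [Finset.sum_apply, Pi.smul_apply, smul_eq_mul]
      linarith
    rw [heq]
    refine Submodule.sum_mem _ fun i _ => Submodule.smul_mem _ _ ?_
    exact simplicialSpan_mono (Finset.insert_subset_insert v (hT i).1)
      (indicator_cone_insert_mem_simplicialSpan ht (fun s hs => hS' s ((hT i).1 hs)) hv1
        (hT i).2.2)

end ConeDecomposition

/-! ### Lattice points in cones -/

/-- The polynomial that interpolates `(n - k + d).choose d` for `n ≥ k` also vanishes at the `d`
preceding integers, as the count it stands for does. -/
theorem eval_preHilbertPoly_of_lt {d k n : ℕ} (hn : n < k) (hk : k ≤ n + d) :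
    (Polynomial.preHilbertPoly ℚ d k).eval (n : ℚ) = 0 := by
  have h : ((n : ℚ) - k + 1) = -((k - n - 1 : ℕ) : ℚ) := by
    rw [Nat.sub_sub, Nat.cast_sub (by omega)]
    push_cast
    ring
  simp only [Polynomial.preHilbertPoly, Polynomial.eval_smul, Polynomial.eval_comp,
    Polynomial.eval_add, Polynomial.eval_sub, Polynomial.eval_X, Polynomial.eval_C,
    Polynomial.eval_one, h]
  rw [ascPochhammer_eval_neg_coe_nat_of_lt (by omega), smul_zero]

/-- For `k < d` the number of `m ∈ ℕ ^ d` with `k + ∑ m = n` is polynomial in `n`, for all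
`n ≥ 0`. -/
theorem natCast_ncard_setOf_sum_add_eq {ι : Type*} [Fintype ι] {k : ℕ}
    (hk : k < Fintype.card ι) (n : ℕ) :
    ({m : ι → ℕ | k + ∑ i, m i = n}.ncard : ℚ) =
      (Polynomial.preHilbertPoly ℚ (Fintype.card ι - 1) k).eval (n : ℚ) := by
  classical
  rcases lt_or_ge n k with hn | hn
  · rw [eval_preHilbertPoly_of_lt hn (by omega)]
    have : {m : ι → ℕ | k + ∑ i, m i = n} = ∅ := by
      refine Set.eq_empty_of_forall_notMem fun m (hm : k + ∑ i, m i = n) => ?_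
      omega
    simp [this]
  · rw [Polynomial.preHilbertPoly_eq_choose_sub_add _ _ hn]
    have h : {m : ι → ℕ | k + ∑ i, m i = n} =
        (fun f : ι →₀ ℕ => (f : ι → ℕ)) ''
          ((Finset.univ.finsuppAntidiag (n - k) : Finset (ι →₀ ℕ)) : Set (ι →₀ ℕ)) := by
      ext m
      constructor
      · intro (hm : k + ∑ i, m i = n)
        refine ⟨Finsupp.equivFunOnFinite.symm m, ?_, rfl⟩
        rw [Finset.mem_coe, Finset.mem_finsuppAntidiag]
        refine ⟨?_, Finset.subset_univ _⟩
        show ∑ i, m i = n - k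
        omega
      · rintro ⟨f, hf, rfl⟩
        rw [Finset.mem_coe, Finset.mem_finsuppAntidiag] at hf
        have : ∑ i, f i = n - k := hf.1
        show k + ∑ i, f i = n
        omega
    rw [h, Set.ncard_image_of_injective _ DFunLike.coe_injective, Set.ncard_coe_finset,
      Finset.card_finsuppAntidiag_nat_eq_choose, Finset.card_univ]
    norm_cast
    rw [← Nat.choose_symm_of_eq_add (n := Fintype.card ι + (n - k) - 1)
      (a := Fintype.card ι - 1) (b := n - k) (by omega)]
    congr 1
    omega

section SimplicialCone

variable {W : Type*} [AddCommGroup W] [Module ℝ W]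

/-- The number of lattice points of height `t` in a simplicial cone with generators of height one
is polynomial in `t`, for all `t ≥ 0`: every such point is uniquely the sum of a point of the half
open parallelepiped and of a natural combination of the generators, and the former has height
less than the number of generators. -/
theorem exists_polynomial_ncard_simplicial (ht : W →ₗ[ℝ] ℝ) (Λ : Submodule ℤ W)
    (hint : ∀ x ∈ Λ, ∃ z : ℤ, ht x = z) {T : Finset W} (hne : T.Nonempty)
    (hT : ∀ s ∈ T, ht s = 1) (hTΛ : ∀ s ∈ T, s ∈ Λ) (hli : LinearIndepOn ℝ id (T : Set W))
    (hfin : ∀ t : ℕ, {x | x ∈ cone T ∧ x ∈ Λ ∧ ht x = t}.Finite) :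
    ∃ f : Polynomial ℚ, ∀ t : ℕ,
      f.eval (t : ℚ) = ({x | x ∈ cone T ∧ x ∈ Λ ∧ ht x = t}.ncard : ℚ) := by
  classical
  -- `c` is the linear parametrization of the span of `T`.
  let c : (T → ℝ) →ₗ[ℝ] W := Fintype.linearCombination ℝ (fun s : T => (s : W))
  have hc : ∀ μ, c μ = ∑ s, μ s • (s : W) := fun μ => rfl
  have hcinj : Function.Injective c :=
    linearIndependent_iff_injective_fintypeLinearCombination.1 hli
  have hht : ∀ μ, ht (c μ) = ∑ s, μ s := fun μ => by
    rw [hc, map_sum]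
    exact Finset.sum_congr rfl fun s _ => by rw [map_smul, hT s s.2, smul_eq_mul, mul_one]
  have hcone : ∀ x, x ∈ cone T ↔ ∃ μ, 0 ≤ μ ∧ c μ = x := by
    intro x
    constructor
    · rintro ⟨μ, hμ, rfl⟩
      refine ⟨fun s => μ s, fun s => hμ s s.2, ?_⟩
      rw [hc, Finset.sum_coe_sort T (fun s => μ s • s)]
    · rintro ⟨μ, hμ, rfl⟩
      refine ⟨fun s => if hs : s ∈ T then μ ⟨s, hs⟩ else 0, fun s hs => ?_, ?_⟩
      · simpa [hs] using hμ ⟨s, hs⟩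
      · rw [hc, ← Finset.sum_coe_sort T]
        simp
  let D : ℕ → Set (T → ℝ) := fun t => {μ | 0 ≤ μ ∧ c μ ∈ Λ ∧ ∑ s, μ s = t}
  have himage : ∀ t : ℕ, {x | x ∈ cone T ∧ x ∈ Λ ∧ ht x = t} = c '' D t := by
    intro t
    ext x
    constructor
    · rintro ⟨hx, hxΛ, hxt⟩
      obtain ⟨μ, hμ, rfl⟩ := (hcone x).1 hx
      exact ⟨μ, ⟨hμ, hxΛ, by rw [← hht, hxt]⟩, rfl⟩
    · rintro ⟨μ, ⟨hμ, hμΛ, hμt⟩, rfl⟩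
      exact ⟨(hcone _).2 ⟨μ, hμ, rfl⟩, hμΛ, by rw [hht, hμt]⟩
  have hDfin : ∀ t, (D t).Finite := fun t =>
    Set.Finite.of_finite_image (himage t ▸ hfin t) hcinj.injOn
  -- the coordinates of the lattice points in the half open parallelepiped
  let B : Set (T → ℝ) := {β | (∀ s, 0 ≤ β s ∧ β s < 1) ∧ c β ∈ Λ}
  have hcard : 0 < Fintype.card T := by
    rw [Fintype.card_coe]; exact hne.card_pos
  have hheight : ∀ β ∈ B, ∃ k : ℕ, k < Fintype.card T ∧ ∑ s, β s = k := by
    rintro β ⟨hβ, hβΛ⟩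
    obtain ⟨z, hz⟩ := hint _ hβΛ
    rw [hht] at hz
    have h0 : (0 : ℝ) ≤ z := hz ▸ Finset.sum_nonneg fun s _ => (hβ s).1
    have h0' : 0 ≤ z := by exact_mod_cast h0
    have : Nonempty T := Fintype.card_pos_iff.1 hcard
    have h1 : ∑ s, β s < ∑ _s : T, (1 : ℝ) :=
      Finset.sum_lt_sum_of_nonempty Finset.univ_nonempty fun s _ => (hβ s).2
    lift z to ℕ using h0'
    refine ⟨z, ?_, by rw [hz]; simp⟩
    rw [hz] at h1
    simp only [Finset.sum_const, Finset.card_univ, nsmul_eq_mul, mul_one] at h1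
    exact_mod_cast h1
  have hBfin : B.Finite := by
    refine (Set.finite_iUnion fun k : Fin (Fintype.card T) => hDfin k).subset fun β hβ => ?_
    obtain ⟨k, hk, hkβ⟩ := hheight β hβ
    exact Set.mem_iUnion.2 ⟨⟨k, hk⟩, fun s => (hβ.1 s).1, hβ.2, hkβ⟩
  choose! k hk hkβ using hheight
  refine ⟨∑ β ∈ hBfin.toFinset, Polynomial.preHilbertPoly ℚ (Fintype.card T - 1) (k β),
    fun t => ?_⟩
  have hcΛ : ∀ m : T → ℤ, c (fun s => (m s : ℝ)) ∈ Λ := by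
    intro m
    rw [hc]
    refine Submodule.sum_mem _ fun s _ => ?_
    rw [Int.cast_smul_eq_zsmul]
    exact Λ.smul_mem _ (hTΛ s s.2)
  have hmaps : ∀ μ ∈ (hDfin t).toFinset, (fun s => Int.fract (μ s)) ∈ hBfin.toFinset := by
    intro μ hμ
    rw [Set.Finite.mem_toFinset] at hμ ⊢
    refine ⟨fun s => ⟨Int.fract_nonneg _, Int.fract_lt_one _⟩, ?_⟩
    have : (fun s => Int.fract (μ s)) = μ - fun s => ((⌊μ s⌋ : ℤ) : ℝ) := by
      funext s
      exact (Int.self_sub_floor (μ s)).symm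
    rw [this, map_sub]
    exact Λ.sub_mem hμ.2.1 (hcΛ _)
  rw [himage, Set.ncard_image_of_injective _ hcinj, Set.ncard_eq_toFinset_card _ (hDfin t),
    Finset.card_eq_sum_card_fiberwise hmaps, Polynomial.eval_finsetSum, Nat.cast_sum]
  refine Finset.sum_congr rfl fun β hβ => ?_
  rw [Set.Finite.mem_toFinset] at hβ
  rw [← natCast_ncard_setOf_sum_add_eq (hk β hβ) t, ← Set.ncard_coe_finset]
  congr 1
  -- the fibre over `β` consists of the `β + m`
  have hfib : ((hDfin t).toFinset.filter fun μ => (fun s => Int.fract (μ s)) = β : Set (T → ℝ)) =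
      (fun m : T → ℕ => fun s => β s + (m s : ℝ)) '' {m | k β + ∑ s, m s = t} := by
    ext μ
    rw [Finset.coe_filter]
    constructor
    · rintro ⟨hμ, hμβ⟩
      rw [Set.Finite.mem_toFinset] at hμ
      have hfl : ∀ s, β s + ((⌊μ s⌋.toNat : ℕ) : ℝ) = μ s := by
        intro s
        have h1 : ((⌊μ s⌋.toNat : ℕ) : ℝ) = ((⌊μ s⌋ : ℤ) : ℝ) := by
          have := Int.toNat_of_nonneg (Int.floor_nonneg.2 (hμ.1 s))
          exact_mod_cast this
        rw [h1, ← hμβ]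
        exact Int.fract_add_floor _
      refine ⟨fun s => ⌊μ s⌋.toNat, ?_, funext hfl⟩
      show k β + _ = t
      have : ((k β + ∑ s, ⌊μ s⌋.toNat : ℕ) : ℝ) = t := by
        push_cast
        rw [← hkβ β hβ, ← hμ.2.2, ← Finset.sum_add_distrib]
        exact Finset.sum_congr rfl fun s _ => hfl s
      exact_mod_cast this
    · rintro ⟨m, hm, rfl⟩
      have hm : k β + ∑ s, m s = t := hm
      refine ⟨?_, ?_⟩
      · rw [Set.Finite.mem_toFinset]
        refine ⟨fun s => add_nonneg (hβ.1 s).1 (Nat.cast_nonneg _), ?_, ?_⟩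
        · have : (fun s => β s + (m s : ℝ)) = β + fun s => (((m s : ℕ) : ℤ) : ℝ) := by
            funext s
            simp
          show c (fun s => β s + (m s : ℝ)) ∈ Λ
          rw [this, map_add]
          exact Λ.add_mem hβ.2 (hcΛ _)
        · rw [Finset.sum_add_distrib, hkβ β hβ, ← hm]
          push_cast
          rfl
      · funext s
        simp only [Int.fract_add_natCast]
        exact Int.fract_eq_self.2 (hβ.1 s)
  rw [hfib, Set.ncard_image_of_injective]
  intro m m' h
  funext s
  have := congrFun h s
  simpa using this

end SimplicialCone

/-! ### Ehrhart's theorem -/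

section Ehrhart

variable {W : Type*} [NormedAddCommGroup W] [NormedSpace ℝ W]

/-- The lattice points of height `t` in a cone with generators of height one: having a polynomial
count passes from the simplicial cones to their integral combinations. -/
theorem exists_polynomial_ncard_cone (ht : W →ₗ[ℝ] ℝ) (Λ : Submodule ℤ W)
    (hint : ∀ x ∈ Λ, ∃ z : ℤ, ht x = z) {S : Finset W} (hne : S.Nonempty)
    (hS : ∀ s ∈ S, ht s = 1) (hSΛ : ∀ s ∈ S, s ∈ Λ)
    (hfin : ∀ t : ℕ, {x | x ∈ cone S ∧ x ∈ Λ ∧ ht x = t}.Finite) :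
    ∃ f : Polynomial ℚ, ∀ t : ℕ,
      f.eval (t : ℚ) = ({x | x ∈ cone S ∧ x ∈ Λ ∧ ht x = t}.ncard : ℚ) := by
  classical
  have hcount : ∀ T ⊆ S, ∀ t : ℕ,
      ((∑ x ∈ (hfin t).toFinset, (cone T).indicator (1 : W → ℤ) x : ℤ) : ℚ) =
        ({x | x ∈ cone T ∧ x ∈ Λ ∧ ht x = t}.ncard : ℚ) := by
    intro T hTS t
    have : {x | x ∈ cone T ∧ x ∈ Λ ∧ ht x = t} =
        ((hfin t).toFinset.filter fun x => x ∈ cone T : Set W) := by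
      ext x
      rw [Finset.coe_filter]
      simp only [Set.Finite.mem_toFinset]
      exact ⟨fun h => ⟨⟨cone_mono hTS h.1, h.2⟩, h.1⟩, fun h => ⟨h.2, h.1.2⟩⟩
    rw [this, Set.ncard_coe_finset, Finset.card_filter]
    push_cast
    refine Finset.sum_congr rfl fun x _ => ?_
    rw [Set.indicator_apply]
    split_ifs <;> simp
  have hspan : ∀ F ∈ simplicialSpan S, ∃ f : Polynomial ℚ, ∀ t : ℕ,
      f.eval (t : ℚ) = ((∑ x ∈ (hfin t).toFinset, F x : ℤ) : ℚ) := by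
    intro F hF
    induction hF using Submodule.span_induction with
    | mem F hF =>
      obtain ⟨T, ⟨hTS, hTne, hTli⟩, rfl⟩ := hF
      obtain ⟨f, hf⟩ := exists_polynomial_ncard_simplicial ht Λ hint hTne
        (fun s hs => hS s (hTS hs)) (fun s hs => hSΛ s (hTS hs)) hTli
        (fun t => (hfin t).subset fun x hx => ⟨cone_mono hTS hx.1, hx.2⟩)
      exact ⟨f, fun t => by rw [hf, ← hcount T hTS t]⟩
    | zero => exact ⟨0, fun t => by simp⟩
    | add F G _ _ hF hG =>
      obtain ⟨f, hf⟩ := hF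
      obtain ⟨g, hg⟩ := hG
      exact ⟨f + g, fun t => by
        simp only [Polynomial.eval_add, hf, hg, Pi.add_apply, Finset.sum_add_distrib]
        push_cast
        rfl⟩
    | smul a F _ hF =>
      obtain ⟨f, hf⟩ := hF
      exact ⟨Polynomial.C (a : ℚ) * f, fun t => by
        simp only [Polynomial.eval_mul, Polynomial.eval_C, hf, Pi.smul_apply, smul_eq_mul,
          ← Finset.mul_sum]
        push_cast
        rfl⟩
  obtain ⟨f, hf⟩ := hspan _ (indicator_cone_mem_simplicialSpan ht hne hS)
  exact ⟨f, fun t => by rw [hf, hcount S subset_rfl t]⟩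

variable {V : Type*} [NormedAddCommGroup V] [NormedSpace ℝ V]

/-- The slice at height `t` of the cone over `P × {1}` is `tP`; at `t = 0` this uses that `P` is
nonempty. -/
theorem mem_smul_convexHull_iff [DecidableEq (V × ℝ)] {S : Finset V} (hS : S.Nonempty) {t : ℝ}
    (ht : 0 ≤ t) {x : V} :
    x ∈ t • convexHull ℝ (S : Set V) ↔ (x, t) ∈ cone (S.image fun s => (s, (1 : ℝ))) := by
  have hinj : Function.Injective fun s : V => (s, (1 : ℝ)) := fun a b h => congrArg Prod.fst h
  have hcone : (x, t) ∈ cone (S.image fun s => (s, (1 : ℝ))) ↔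
      ∃ μ : V → ℝ, (∀ s ∈ S, 0 ≤ μ s) ∧ ∑ s ∈ S, μ s = t ∧ ∑ s ∈ S, μ s • s = x := by
    constructor
    · rintro ⟨μ, hμ, h⟩
      rw [Finset.sum_image hinj.injOn] at h
      refine ⟨fun s => μ (s, 1), fun s hs => hμ _ (Finset.mem_image_of_mem _ hs), ?_, ?_⟩
      · simpa [Prod.snd_sum] using congrArg Prod.snd h
      · simpa [Prod.fst_sum] using congrArg Prod.fst h
    · rintro ⟨μ, hμ, h1, h2⟩
      refine ⟨fun w => μ w.1, fun w hw => ?_, ?_⟩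
      · obtain ⟨s, hs, rfl⟩ := Finset.mem_image.1 hw
        exact hμ s hs
      · rw [Finset.sum_image hinj.injOn]
        ext
        · simpa [Prod.fst_sum] using h2
        · simpa [Prod.snd_sum] using h1
  rw [hcone]
  constructor
  · rintro ⟨y, hy, rfl⟩
    obtain ⟨w, hw, hw1, rfl⟩ := Finset.mem_convexHull'.1 hy
    exact ⟨fun s => t * w s, fun s hs => mul_nonneg ht (hw s hs), by
      rw [← Finset.mul_sum, hw1, mul_one], by simp only [mul_smul, ← Finset.smul_sum]⟩
  · rintro ⟨μ, hμ, h1, rfl⟩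
    rcases ht.eq_or_lt with rfl | hpos
    · have h0 := (Finset.sum_eq_zero_iff_of_nonneg hμ).1 h1
      rw [Finset.sum_eq_zero fun s hs => by rw [h0 s hs, zero_smul],
        Set.zero_smul_set (convexHull_nonempty_iff.2 hS.to_set)]
      rfl
    · refine ⟨∑ s ∈ S, (t⁻¹ * μ s) • s, Finset.mem_convexHull'.2
        ⟨fun s => t⁻¹ * μ s, fun s hs => mul_nonneg (inv_nonneg.2 ht) (hμ s hs), ?_, rfl⟩, ?_⟩
      · rw [← Finset.mul_sum, h1, inv_mul_cancel₀ hpos.ne']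
      · simp only [mul_smul, ← Finset.smul_sum]
        exact smul_inv_smul₀ hpos.ne' _

/-- Ehrhart's theorem. -/
theorem exists_isEhrhartPolynomial {M : Submodule ℤ V}
    (hM : ∀ K : Set V, Bornology.IsBounded K → (K ∩ M).Finite) {S : Finset V} (hne : S.Nonempty)
    (hS : ∀ s ∈ S, s ∈ M) : ∃ f, IsEhrhartPolynomial M (convexHull ℝ (S : Set V)) f := by
  classical
  let Λ : Submodule ℤ (V × ℝ) := M.prod (LinearMap.range (Algebra.linearMap ℤ ℝ))
  have hlevel : ∀ t : ℕ, {x | x ∈ cone (S.image fun s => (s, (1 : ℝ))) ∧ x ∈ Λ ∧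
      LinearMap.snd ℝ V ℝ x = t} =
      (fun x : V => (x, (t : ℝ))) '' ((t : ℝ) • convexHull ℝ (S : Set V) ∩ M) := by
    intro t
    ext ⟨x, r⟩
    constructor
    · rintro ⟨hx, hxΛ, hr⟩
      have hr : r = t := hr
      subst hr
      exact ⟨x, ⟨(mem_smul_convexHull_iff hne t.cast_nonneg).2 hx, hxΛ.1⟩, rfl⟩
    · rintro ⟨y, ⟨hy, hyM⟩, h⟩
      obtain ⟨rfl, rfl⟩ := Prod.mk.inj h
      exact ⟨(mem_smul_convexHull_iff hne t.cast_nonneg).1 hy, ⟨hyM, (t : ℤ), by simp⟩, rfl⟩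
  have hinj : ∀ t : ℕ, Function.Injective fun x : V => (x, (t : ℝ)) :=
    fun t a b h => congrArg Prod.fst h
  obtain ⟨f, hf⟩ := exists_polynomial_ncard_cone (LinearMap.snd ℝ V ℝ) Λ
    (by rintro x ⟨_, z, hz⟩; exact ⟨z, hz.symm⟩) (hne.image fun s => (s, (1 : ℝ)))
    (by
      intro s hs
      obtain ⟨s, -, rfl⟩ := Finset.mem_image.1 hs
      rfl)
    (by
      intro s hs
      obtain ⟨s, hsS, rfl⟩ := Finset.mem_image.1 hs
      exact ⟨hS s hsS, 1, by simp⟩)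
    (fun t => by
      rw [hlevel t]
      refine (hM _ ?_).image _
      exact ((isBounded_convexHull.2 S.finite_toSet.isBounded).smul₀ (t : ℝ)))
  refine ⟨f, fun t => ?_⟩
  rw [hf t, hlevel t, Set.ncard_image_of_injective _ (hinj t)]

theorem IsEhrhartPolynomial.ehrhartPolynomial {M : Submodule ℤ V} {P : Set V} {f : Polynomial ℚ}
    (hf : IsEhrhartPolynomial M P f) : IsEhrhartPolynomial M P (ehrhartPolynomial M P) := by
  have h : ∃ f, IsEhrhartPolynomial M P f := ⟨f, hf⟩
  rw [HeckeEhrhart.ehrhartPolynomial, dif_pos h]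
  exact h.choose_spec

end Ehrhart

/-! ### Gaussian binomial coefficients -/

section GaussianBinomial

open Polynomial

/-- The Gaussian binomial coefficient, defined by its Pascal recursion as a polynomial over `ℕ`, so
that it visibly has no negative coefficients. -/
def gaussBinom : ℕ → ℕ → ℕ[X]
  | _, 0 => 1
  | 0, _ + 1 => 0
  | n + 1, k + 1 => gaussBinom n k + X ^ (k + 1) * gaussBinom n (k + 1)

theorem gaussBinom_zero_right (n : ℕ) : gaussBinom n 0 = 1 := by
  cases n <;> rfl

theorem gaussBinom_succ_succ (n k : ℕ) :
    gaussBinom (n + 1) (k + 1) = gaussBinom n k + X ^ (k + 1) * gaussBinom n (k + 1) := rfl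

theorem aeval_gaussBinom_succ_succ (x : ℤ) (n k : ℕ) :
    aeval x (gaussBinom (n + 1) (k + 1)) =
      aeval x (gaussBinom n k) + x ^ (k + 1) * aeval x (gaussBinom n (k + 1)) := by
  simp [gaussBinom_succ_succ]

/-- The relation between horizontally adjacent Gaussian binomials. The factor `x ^ k` avoids the
truncated difference `n - k`. -/
theorem pow_mul_aeval_gaussBinom_succ_right (x : ℤ) (n k : ℕ) :
    x ^ k * (x ^ (k + 1) - 1) * aeval x (gaussBinom n (k + 1)) =
      (x ^ n - x ^ k) * aeval x (gaussBinom n k) := by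
  induction n generalizing k with
  | zero => cases k <;> simp [gaussBinom]
  | succ n ih =>
    rw [aeval_gaussBinom_succ_succ]
    cases k with
    | zero =>
      have := ih 0
      simp only [gaussBinom_zero_right, map_one] at this ⊢
      linear_combination x * this
    | succ k =>
      rw [aeval_gaussBinom_succ_succ]
      linear_combination x ^ (k + 2) * ih (k + 1) + x * ih k

/-- The absorption identity; it matches the recursion found by counting the nonzero vectors of all
`(k + 1)`-dimensional subspaces. -/
theorem sub_one_mul_aeval_gaussBinom_succ_succ (x : ℤ) (n k : ℕ) :
    (x ^ (k + 1) - 1) * aeval x (gaussBinom (n + 1) (k + 1)) =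
      (x ^ (n + 1) - 1) * aeval x (gaussBinom n k) := by
  rw [aeval_gaussBinom_succ_succ]
  linear_combination x * pow_mul_aeval_gaussBinom_succ_right x n k

end GaussianBinomial

/-! ### Counting subspaces over a finite field -/

section Subspaces

open Module

variable {F : Type*} [Field F] [Finite F]

/-- Double counting of the pairs `(W, u)` with `W ∈ S` and `u ∈ W ∩ U`. -/
theorem sum_card_pow_finrank_inf {V : Type*} [AddCommGroup V] [Module F V] [FiniteDimensional F V]
    (S : Finset (Submodule F V)) {N : ℕ}
    (hN : ∀ u : V, u ≠ 0 → {W | W ∈ S ∧ u ∈ W}.ncard = N) (U : Submodule F V) :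
    ((∑ W ∈ S, Nat.card F ^ finrank F (W ⊓ U : Submodule F V) : ℕ) : ℤ) =
      S.card + ((Nat.card F : ℤ) ^ finrank F U - 1) * N := by
  classical
  have : Finite V := Module.finite_of_finite F
  have : Fintype V := Fintype.ofFinite V
  have h1 : ∀ W ∈ S, Nat.card F ^ finrank F (W ⊓ U : Submodule F V) =
      ({u ∈ Finset.univ.filter (· ∈ U) | u ∈ W} : Finset V).card := by
    intro W _
    rw [← Module.natCard_eq_pow_finrank, ← Set.ncard_coe_finset, ← Nat.card_coe_set_eq]
    refine Nat.card_congr (Equiv.setCongr ?_)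
    ext u
    simp [and_comm]
  have h2 : ∀ u : V, ({W ∈ S | u ∈ W} : Finset (Submodule F V)).card =
      if u = 0 then S.card else N := by
    intro u
    split_ifs with hu
    · subst hu
      simp
    · rw [← hN u hu, ← Set.ncard_coe_finset, Finset.coe_filter]
  have hU : (Finset.univ.filter (· ∈ U)).card = Nat.card F ^ finrank F U := by
    rw [← Module.natCard_eq_pow_finrank, ← Set.ncard_coe_finset, ← Nat.card_coe_set_eq]
    refine Nat.card_congr (Equiv.setCongr ?_)
    ext u
    simp
  have h0U : (0 : V) ∈ Finset.univ.filter (· ∈ U) := by simp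
  have hswap := Finset.sum_card_bipartiteAbove_eq_sum_card_bipartiteBelow
    (fun (W : Submodule F V) (u : V) => u ∈ W) (s := S) (t := Finset.univ.filter (· ∈ U))
  simp only [Finset.bipartiteAbove, Finset.bipartiteBelow] at hswap
  rw [Finset.sum_congr rfl h1, hswap, Finset.sum_congr rfl fun u _ => h2 u,
    ← Finset.add_sum_erase _ _ h0U, if_pos rfl,
    Finset.sum_congr rfl fun u hu => if_neg (Finset.ne_of_mem_erase hu), Finset.sum_const,
    Finset.card_erase_of_mem h0U, hU, smul_eq_mul]
  have : 1 ≤ Nat.card F ^ finrank F U := Nat.one_le_pow _ _ Nat.card_pos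
  push_cast [Nat.cast_sub this]
  rfl

omit [Finite F] in
theorem finrank_comap_mkQ_span_singleton {V : Type*} [AddCommGroup V] [Module F V]
    [FiniteDimensional F V] {u : V} (hu : u ≠ 0) (W : Submodule F (V ⧸ F ∙ u)) :
    finrank F (W.comap (F ∙ u).mkQ) = finrank F W + 1 := by
  -- The third isomorphism theorem gives the same codimension for `W` and its preimage.
  have hle : F ∙ u ≤ W.comap (F ∙ u).mkQ := by
    simpa using Submodule.comap_mono (f := (F ∙ u).mkQ) (bot_le : ⊥ ≤ W)
  have e := (Submodule.quotientQuotientEquivQuotient (F ∙ u) _ hle).finrank_eq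
  rw [Submodule.map_comap_eq_of_surjective (Submodule.mkQ_surjective _)] at e
  have h1 := Submodule.finrank_quotient_add_finrank W
  have h2 := Submodule.finrank_quotient_add_finrank (W.comap (F ∙ u).mkQ)
  have h3 := Submodule.finrank_quotient_add_finrank (F ∙ u)
  rw [finrank_span_singleton hu] at h3
  omega

omit [Finite F] in
/-- The subspaces that contain a given line correspond to the subspaces of the quotient by it. -/
theorem ncard_setOf_finrank_eq_succ_and_mem {V : Type*} [AddCommGroup V] [Module F V]
    [FiniteDimensional F V] {u : V} (hu : u ≠ 0) (k : ℕ) :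
    {W : Submodule F V | finrank F W = k + 1 ∧ u ∈ W}.ncard =
      {W : Submodule F (V ⧸ F ∙ u) | finrank F W = k}.ncard := by
  have : {W : Submodule F V | finrank F W = k + 1 ∧ u ∈ W} =
      Submodule.comap (F ∙ u).mkQ '' {W : Submodule F (V ⧸ F ∙ u) | finrank F W = k} := by
    ext W
    constructor
    · rintro ⟨hW, huW⟩
      have hle : F ∙ u ≤ W := (Submodule.span_singleton_le_iff_mem u W).2 huW
      have heq : (W.map (F ∙ u).mkQ).comap (F ∙ u).mkQ = W := by
        rw [Submodule.comap_map_mkQ, sup_eq_right.2 hle]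
      refine ⟨W.map (F ∙ u).mkQ, ?_, heq⟩
      have := finrank_comap_mkQ_span_singleton hu (W.map (F ∙ u).mkQ)
      rw [heq, hW] at this
      exact (Nat.succ_injective this).symm
    · rintro ⟨W, hW, rfl⟩
      refine ⟨by rw [finrank_comap_mkQ_span_singleton hu, hW], ?_⟩
      have : (F ∙ u).mkQ u = 0 :=
        (Submodule.Quotient.mk_eq_zero _).2 (Submodule.mem_span_singleton_self u)
      rw [Submodule.mem_comap, this]
      exact W.zero_mem
  rw [this, Set.ncard_image_of_injective _
    (Submodule.comap_injective_of_surjective (Submodule.mkQ_surjective _))]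

/-- The number of `k`-dimensional subspaces of an `n`-dimensional space over a finite field. -/
theorem ncard_setOf_finrank_eq {n k : ℕ} {V : Type*} [AddCommGroup V] [Module F V]
    [FiniteDimensional F V] (hV : finrank F V = n) :
    ({W : Submodule F V | finrank F W = k}.ncard : ℤ) =
      Polynomial.aeval (Nat.card F : ℤ) (gaussBinom n k) := by
  induction n generalizing k V with
  | zero =>
    have hall : ∀ W : Submodule F V, finrank F W = 0 := fun W =>
      Nat.le_zero.1 (hV ▸ Submodule.finrank_le W)
    cases k with
    | zero =>
      have : {W : Submodule F V | finrank F W = 0} = {⊥} := by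
        ext W
        exact Submodule.finrank_eq_zero
      rw [this]
      simp [gaussBinom]
    | succ k =>
      have : {W : Submodule F V | finrank F W = k + 1} = ∅ :=
        Set.eq_empty_of_forall_notMem fun W (hW : finrank F W = k + 1) => by
          have := hall W
          omega
      rw [this]
      simp [gaussBinom]
  | succ n ih =>
    cases k with
    | zero =>
      have : {W : Submodule F V | finrank F W = 0} = {⊥} := by
        ext W
        exact Submodule.finrank_eq_zero
      rw [this]
      simp [gaussBinom]
    | succ k =>
      have : Finite V := Module.finite_of_finite F
      have hnt : Nontrivial V := Module.nontrivial_of_finrank_pos (R := F) (by omega)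
      have hcount : ∀ u : V, u ≠ 0 →
          ({W : Submodule F V | finrank F W = k + 1 ∧ u ∈ W}.ncard : ℤ) =
            Polynomial.aeval (Nat.card F : ℤ) (gaussBinom n k) := by
        intro u hu
        rw [ncard_setOf_finrank_eq_succ_and_mem hu, ih]
        have := Submodule.finrank_quotient_add_finrank (F ∙ u)
        rw [finrank_span_singleton hu] at this
        omega
      obtain ⟨u₀, hu₀⟩ := exists_ne (0 : V)
      have hfin : {W : Submodule F V | finrank F W = k + 1}.Finite := Set.toFinite _
      have hN : ∀ u : V, u ≠ 0 → {W | W ∈ hfin.toFinset ∧ u ∈ W}.ncard =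
          {W : Submodule F V | finrank F W = k + 1 ∧ u₀ ∈ W}.ncard := by
        intro u hu
        simp only [Set.Finite.mem_toFinset]
        have := (hcount u hu).trans (hcount u₀ hu₀).symm
        exact_mod_cast this
      -- With `U = ⊤` the double count reads `q ^ (k + 1) * N₀ = N₀ + (q ^ (n + 1) - 1) * N₁`.
      have hdc := sum_card_pow_finrank_inf hfin.toFinset hN ⊤
      rw [hcount u₀ hu₀, finrank_top, hV, ← Set.ncard_eq_toFinset_card _ hfin,
        Finset.sum_congr rfl fun W hW => by
          rw [inf_top_eq, show finrank F W = k + 1 from (Set.Finite.mem_toFinset hfin).1 hW],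
        Finset.sum_const, ← Set.ncard_eq_toFinset_card _ hfin, smul_eq_mul] at hdc
      push_cast at hdc
      have hq : (1 : ℤ) < Nat.card F := by exact_mod_cast Finite.one_lt_card
      have hq1 : ((Nat.card F : ℤ) ^ (k + 1) - 1) ≠ 0 := by
        have := one_lt_pow₀ hq (Nat.succ_ne_zero k)
        exact sub_ne_zero.2 this.ne'
      refine mul_left_cancel₀ hq1 ?_
      rw [sub_one_mul_aeval_gaussBinom_succ_succ]
      linear_combination hdc

/-- The number of `k`-dimensional subspaces through a nonzero vector, as a polynomial in the order
of the field. -/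
def gaussBinomThrough : ℕ → ℕ → Polynomial ℕ
  | n + 1, k + 1 => gaussBinom n k
  | _, _ => 0

theorem ncard_setOf_finrank_eq_and_mem {n k : ℕ} {V : Type*} [AddCommGroup V] [Module F V]
    [FiniteDimensional F V] (hV : finrank F V = n) {u : V} (hu : u ≠ 0) :
    ({W : Submodule F V | finrank F W = k ∧ u ∈ W}.ncard : ℤ) =
      Polynomial.aeval (Nat.card F : ℤ) (gaussBinomThrough n k) := by
  have := Submodule.finrank_quotient_add_finrank (F ∙ u)
  rw [finrank_span_singleton hu, hV] at this
  cases n with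
  | zero => omega
  | succ n =>
    cases k with
    | zero =>
      have : {W : Submodule F V | finrank F W = 0 ∧ u ∈ W} = ∅ :=
        Set.eq_empty_of_forall_notMem fun W hW => hu <| by
          simpa [Submodule.finrank_eq_zero.1 hW.1] using hW.2
      rw [this]
      simp [gaussBinomThrough]
    | succ k =>
      rw [ncard_setOf_finrank_eq_succ_and_mem hu, ncard_setOf_finrank_eq (n := n) (by omega)]
      rfl

end Subspaces

/-! ### The eigenvalues -/

section Nu

open Module

variable {p : ℕ} [Fact p.Prime] {n : ℕ}

theorem nu_eq (k : ℕ) (U : Submodule (ZMod p) (Fin n → ZMod p)) :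
    (nu k U : ℤ) = Polynomial.aeval (p : ℤ) (gaussBinom n k) +
      ((p : ℤ) ^ finrank (ZMod p) U - 1) * Polynomial.aeval (p : ℤ) (gaussBinomThrough n k) := by
  have hV : finrank (ZMod p) (Fin n → ZMod p) = n := Module.finrank_fin_fun _
  have hp : Nat.card (ZMod p) = p := Nat.card_zmod p
  have hfin : {W : Submodule (ZMod p) (Fin n → ZMod p) | finrank (ZMod p) W = k}.Finite :=
    Set.toFinite _
  have hN : ∀ u : Fin n → ZMod p, u ≠ 0 → {W | W ∈ hfin.toFinset ∧ u ∈ W}.ncard =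
      (Polynomial.aeval (p : ℤ) (gaussBinomThrough n k)).toNat := by
    intro u hu
    simp only [Set.Finite.mem_toFinset]
    have := ncard_setOf_finrank_eq_and_mem (k := k) hV hu
    rw [hp] at this
    rw [← this]
    rfl
  have h := sum_card_pow_finrank_inf hfin.toFinset hN U
  rw [hp, ← Set.ncard_eq_toFinset_card _ hfin, ncard_setOf_finrank_eq hV, hp] at h
  have hnonneg : 0 ≤ Polynomial.aeval (p : ℤ) (gaussBinomThrough n k) := by
    rw [Polynomial.aeval_eq_sum_range]
    exact Finset.sum_nonneg fun i _ => by positivity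
  rw [Int.toNat_of_nonneg hnonneg] at h
  exact h

/-- The eigenvalue `ν_{n,k,l}` as a polynomial over `ℕ`. -/
def nuPolynomial : ℕ → ℕ → ℕ → Polynomial ℕ
  | n + 1, k + 1, l =>
    Polynomial.X ^ l * gaussBinom n k + Polynomial.X ^ (k + 1) * gaussBinom n (k + 1)
  | n, k, _ => gaussBinom n k

theorem aeval_nuPolynomial (k : ℕ) (U : Submodule (ZMod p) (Fin n → ZMod p)) :
    Polynomial.aeval (p : ℤ) (nuPolynomial n k (finrank (ZMod p) U)) = (nu k U : ℤ) := by
  rw [nu_eq]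
  match n, k, finrank (ZMod p) U with
  | n + 1, k + 1, l =>
    rw [aeval_gaussBinom_succ_succ]
    simp only [nuPolynomial, gaussBinomThrough, map_add, map_mul, map_pow, Polynomial.aeval_X]
    ring
  | 0, k, l => cases k <;> simp [nuPolynomial, gaussBinomThrough]
  | n + 1, 0, l => simp [nuPolynomial, gaussBinomThrough]

theorem nu_eq_of_finrank_eq (k : ℕ) {U U' : Submodule (ZMod p) (Fin n → ZMod p)}
    (h : finrank (ZMod p) U = finrank (ZMod p) U') : nu k U = nu k U' := by
  have := aeval_nuPolynomial k U
  rw [h, aeval_nuPolynomial] at this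
  exact_mod_cast this.symm

theorem nu_pos {k : ℕ} (hk : k ≤ n) (U : Submodule (ZMod p) (Fin n → ZMod p)) : 0 < nu k U := by
  have hp : 0 < p := (Fact.out : p.Prime).pos
  obtain ⟨s, hs, hli⟩ := exists_finset_linearIndependent_of_le_finrank (R := ZMod p)
    (M := Fin n → ZMod p) (n := k) (by rwa [Module.finrank_fin_fun])
  refine Finset.sum_pos (fun W _ => pow_pos hp _)
    ⟨Submodule.span (ZMod p) (s : Set (Fin n → ZMod p)), ?_⟩
  rw [Set.Finite.mem_toFinset]
  exact (finrank_span_finset_eq_card hli).trans hs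

theorem nondegenerate_dotProductBilin {F : Type*} [Field F] (n : ℕ) :
    LinearMap.BilinForm.Nondegenerate
      (dotProductBilin F F : LinearMap.BilinForm F (Fin n → F)) := by
  constructor
  · intro x hx
    exact dotProduct_eq_zero_iff.1 hx
  · intro y hy
    refine dotProduct_eq_zero_iff.1 fun w => ?_
    rw [dotProduct_comm]
    exact hy w

/-- Duality: `W ↦ Wᗮ` exchanges the dimensions `k` and `n - k`, and
`dim (W ∩ U) + n = k + l + dim (Wᗮ ∩ Uᗮ)`. -/
theorem nu_mul_pow_eq {k l : ℕ} (hk : k ≤ n) (U : Submodule (ZMod p) (Fin n → ZMod p))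
    (hU : finrank (ZMod p) U = l) :
    nu k U * p ^ n = p ^ (k + l) *
      nu (n - k) (LinearMap.BilinForm.orthogonal (dotProductBilin (ZMod p) (ZMod p)) U) := by
  set B : LinearMap.BilinForm (ZMod p) (Fin n → ZMod p) := dotProductBilin (ZMod p) (ZMod p)
  have hBapp : ∀ x y, B x y = x ⬝ᵥ y := fun _ _ => rfl
  have hnd : B.Nondegenerate := nondegenerate_dotProductBilin n
  have hrefl : B.IsRefl := fun x y h => by
    rw [hBapp] at h ⊢
    rwa [dotProduct_comm]
  have hV : finrank (ZMod p) (Fin n → ZMod p) = n := Module.finrank_fin_fun _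
  have horth : ∀ W, finrank (ZMod p) (B.orthogonal W) = n - finrank (ZMod p) W := fun W => by
    rw [LinearMap.BilinForm.finrank_orthogonal hnd, hV]
  have hle : ∀ W : Submodule (ZMod p) (Fin n → ZMod p), finrank (ZMod p) W ≤ n := fun W =>
    (Submodule.finrank_le W).trans hV.le
  have hinf : ∀ W, B.orthogonal W ⊓ B.orthogonal U = B.orthogonal (W ⊔ U) := by
    intro W
    refine le_antisymm ?_ (le_inf (LinearMap.BilinForm.orthogonal_le le_sup_left)
      (LinearMap.BilinForm.orthogonal_le le_sup_right))
    rintro x ⟨hxW, hxU⟩ y hy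
    obtain ⟨w, hw, u, hu, rfl⟩ := Submodule.mem_sup.1 hy
    have h1 := hxW w hw
    have h2 := hxU u hu
    change B w x = 0 at h1
    change B u x = 0 at h2
    change B (w + u) x = 0
    rw [map_add, LinearMap.add_apply, h1, h2, add_zero]
  rw [nu, nu, Finset.sum_mul, Finset.mul_sum]
  refine Finset.sum_bij' (fun W _ => B.orthogonal W) (fun W _ => B.orthogonal W) ?_ ?_ ?_ ?_ ?_
  · intro W hW
    rw [Set.Finite.mem_toFinset] at hW ⊢
    exact (horth W).trans (by rw [show finrank (ZMod p) W = k from hW])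
  · intro W hW
    rw [Set.Finite.mem_toFinset] at hW ⊢
    exact (horth W).trans (by rw [show finrank (ZMod p) W = n - k from hW]; omega)
  · intro W _
    exact LinearMap.BilinForm.orthogonal_orthogonal hnd hrefl W
  · intro W _
    exact LinearMap.BilinForm.orthogonal_orthogonal hnd hrefl W
  · intro W hW
    rw [Set.Finite.mem_toFinset] at hW
    have hW : finrank (ZMod p) W = k := hW
    rw [hinf, horth, ← pow_add, ← pow_add]
    have := Submodule.finrank_sup_add_finrank_inf_eq W U
    have := hle (W ⊔ U)
    congr 1
    omega

theorem nu_div_nu {k l : ℕ} (hk : k ≤ n) {U U' : Submodule (ZMod p) (Fin n → ZMod p)}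
    (hU : finrank (ZMod p) U = l) (hU' : finrank (ZMod p) U' = n - l) :
    (nu k U : ℚ) / (nu (n - k) U' : ℚ) = (p : ℚ) ^ ((k : ℤ) + (l : ℤ) - (n : ℤ)) := by
  have hp : (p : ℚ) ≠ 0 := by exact_mod_cast (Fact.out : p.Prime).ne_zero
  have hpos : (nu (n - k) U' : ℚ) ≠ 0 := by exact_mod_cast (nu_pos (Nat.sub_le n k) U').ne'
  have h := nu_mul_pow_eq hk U hU
  rw [nu_eq_of_finrank_eq (n - k) (U' := U') (by
    rw [hU', LinearMap.BilinForm.finrank_orthogonal (nondegenerate_dotProductBilin n), hU,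
      Module.finrank_fin_fun])] at h
  rw [zpow_sub₀ hp, div_eq_div_iff hpos (zpow_ne_zero _ hp), ← Nat.cast_add, zpow_natCast,
    zpow_natCast]
  exact_mod_cast h

end Nu

/-! ### Superlattices and subspaces -/

section Superlattices

open Module

variable {V : Type*} [NormedAddCommGroup V] [NormedSpace ℝ V] {L : Submodule ℤ V} {n : ℕ}

/-- The homomorphism from `p⁻¹L` to `𝔽_p ^ n` that sends `x` to the coordinates of `p x` modulo
`p`. It identifies `p⁻¹L / L` with `𝔽_p ^ n`. -/
def residueHom (p : ℕ) (b : Basis (Fin n) ℤ L) : invSMul p L →+ (Fin n → ZMod p) :=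
  ((Int.castAddHom (ZMod p)).compLeft (Fin n)).comp <|
    (b.equivFun.toLinearMap.comp
      ((LinearMap.lsmul ℤ V (p : ℤ)).restrict fun _ hx => mem_invSMul.1 hx)).toAddMonoidHom

theorem residueHom_apply (p : ℕ) (b : Basis (Fin n) ℤ L) (x : invSMul p L) (i : Fin n) :
    residueHom p b x i = ((b.repr ⟨(p : ℤ) • (x : V), mem_invSMul.1 x.2⟩ i : ℤ) : ZMod p) :=
  rfl

theorem zsmul_injective_of_ne_zero {p : ℕ} (hp : p ≠ 0) :
    Function.Injective fun x : V => (p : ℤ) • x := by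
  intro x y h
  dsimp only at h
  rw [← Int.cast_smul_eq_zsmul ℝ, ← Int.cast_smul_eq_zsmul ℝ] at h
  exact smul_right_injective V (by exact_mod_cast hp) h

theorem residueHom_eq_zero_iff {p : ℕ} (hp : p ≠ 0) (b : Basis (Fin n) ℤ L) (x : invSMul p L) :
    residueHom p b x = 0 ↔ (x : V) ∈ L := by
  constructor
  · intro h
    have hdvd : ∀ i, ∃ z : ℤ, b.repr ⟨(p : ℤ) • (x : V), mem_invSMul.1 x.2⟩ i = p * z := by
      intro i
      have := congrFun h i
      rw [residueHom_apply] at this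
      exact (ZMod.intCast_zmod_eq_zero_iff_dvd _ _).1 this
    choose z hz using hdvd
    have hsum := b.sum_repr ⟨(p : ℤ) • (x : V), mem_invSMul.1 x.2⟩
    simp only [hz, mul_smul, ← Finset.smul_sum] at hsum
    have h1 : (p : ℤ) • ((∑ i, z i • b i : L) : V) = (p : ℤ) • (x : V) :=
      congrArg Subtype.val hsum
    rw [← zsmul_injective_of_ne_zero hp h1]
    exact Subtype.property _
  · intro h
    funext i
    rw [residueHom_apply]
    have : (⟨(p : ℤ) • (x : V), mem_invSMul.1 x.2⟩ : L) = (p : ℤ) • ⟨(x : V), h⟩ := rfl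
    rw [this, map_smul]
    simp

theorem residueHom_surjective {p : ℕ} (hp : p ≠ 0) (b : Basis (Fin n) ℤ L) :
    Function.Surjective (residueHom p b) := by
  intro v
  choose z hz using fun i => ZMod.intCast_surjective (v i)
  let y : L := ∑ i, z i • b i
  have hy : (p : ℤ) • ((p : ℝ)⁻¹ • (y : V)) = y := by
    rw [← Int.cast_smul_eq_zsmul ℝ, Int.cast_natCast]
    exact smul_inv_smul₀ (by exact_mod_cast hp) _
  refine ⟨⟨(p : ℝ)⁻¹ • (y : V), mem_invSMul.2 (by rw [hy]; exact y.2)⟩, funext fun i => ?_⟩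
  rw [residueHom_apply, ← hz i]
  have : (⟨(p : ℤ) • ((p : ℝ)⁻¹ • (y : V)), by rw [hy]; exact y.2⟩ : L) = y := Subtype.ext hy
  rw [this]
  congr 1
  exact congrFun (b.equivFun.apply_symm_apply z ▸ congrArg b.equivFun (b.equivFun_symm_apply z).symm
    : b.equivFun y = z) i

/-- The lattice between `L` and `p⁻¹L` that corresponds to a subspace of `𝔽_p ^ n`. -/
def superlatticeOf (p : ℕ) (b : Basis (Fin n) ℤ L)
    (W : AddSubgroup (Fin n → ZMod p)) : Submodule ℤ V :=
  AddSubgroup.toIntSubmodule ((W.comap (residueHom p b)).map (invSMul p L).subtype.toAddMonoidHom)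

theorem mem_superlatticeOf {p : ℕ} {b : Basis (Fin n) ℤ L} {W : AddSubgroup (Fin n → ZMod p)}
    (x : invSMul p L) : (x : V) ∈ superlatticeOf p b W ↔ residueHom p b x ∈ W := by
  constructor
  · rintro ⟨y, hy, h⟩
    rwa [← Subtype.ext h]
  · intro h
    exact ⟨x, h, rfl⟩

theorem superlatticeOf_le_invSMul {p : ℕ} {b : Basis (Fin n) ℤ L}
    {W : AddSubgroup (Fin n → ZMod p)} : superlatticeOf p b W ≤ invSMul p L := by
  rintro _ ⟨y, _, rfl⟩
  exact y.2

theorem le_invSMul (p : ℕ) (L : Submodule ℤ V) : L ≤ invSMul p L :=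
  fun _ hx => mem_invSMul.2 (L.smul_mem _ hx)

theorem le_superlatticeOf {p : ℕ} (hp : p ≠ 0) {b : Basis (Fin n) ℤ L}
    {W : AddSubgroup (Fin n → ZMod p)} : L ≤ superlatticeOf p b W := by
  intro x hx
  refine (mem_superlatticeOf ⟨x, le_invSMul p L hx⟩).2 ?_
  rw [(residueHom_eq_zero_iff hp b ⟨x, le_invSMul p L hx⟩).2 hx]
  exact W.zero_mem

theorem superlatticeOf_injective {p : ℕ} (hp : p ≠ 0) (b : Basis (Fin n) ℤ L) :
    Function.Injective (superlatticeOf p b) := by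
  intro W W' h
  ext v
  obtain ⟨x, rfl⟩ := residueHom_surjective hp b v
  rw [← mem_superlatticeOf, h, mem_superlatticeOf]

theorem relIndex_superlatticeOf {p : ℕ} (hp : p ≠ 0) (b : Basis (Fin n) ℤ L)
    (W : AddSubgroup (Fin n → ZMod p)) :
    L.toAddSubgroup.relIndex (superlatticeOf p b W).toAddSubgroup = Nat.card W := by
  have hL : L.toAddSubgroup =
      (residueHom p b).ker.map (invSMul p L).subtype.toAddMonoidHom := by
    ext x
    constructor
    · intro hx
      exact ⟨⟨x, le_invSMul p L hx⟩, (residueHom_eq_zero_iff hp b _).2 hx, rfl⟩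
    · rintro ⟨y, hy, rfl⟩
      exact (residueHom_eq_zero_iff hp b y).1 hy
  have hW : (superlatticeOf p b W).toAddSubgroup =
      (W.comap (residueHom p b)).map (invSMul p L).subtype.toAddMonoidHom := rfl
  have hker : (invSMul p L).subtype.toAddMonoidHom.ker = ⊥ :=
    (AddMonoidHom.ker_eq_bot_iff _).2 Subtype.val_injective
  rw [hL, hW, AddSubgroup.relIndex_map_map, hker, sup_bot_eq, sup_bot_eq,
    AddSubgroup.relIndex_ker,
    AddSubgroup.map_comap_eq_self_of_surjective (residueHom_surjective hp b)]

theorem superlattices_eq_image {p : ℕ} [hp : Fact p.Prime] (k : ℕ) (b : Basis (Fin n) ℤ L) :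
    superlattices p k L =
      (fun W : Submodule (ZMod p) (Fin n → ZMod p) => superlatticeOf p b W.toAddSubgroup) ''
        {W | finrank (ZMod p) W = k} := by
  have hp0 := hp.out.ne_zero
  have hcard : ∀ W : Submodule (ZMod p) (Fin n → ZMod p),
      Nat.card W.toAddSubgroup = p ^ finrank (ZMod p) W := by
    intro W
    have := Module.natCard_eq_pow_finrank (K := ZMod p) (V := W)
    rwa [Nat.card_zmod] at this
  ext M
  constructor
  · rintro ⟨hLM, hMp, hidx⟩
    set W : AddSubgroup (Fin n → ZMod p) :=
      (M.toAddSubgroup.comap (invSMul p L).subtype.toAddMonoidHom).map (residueHom p b) with hW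
    have hM : superlatticeOf p b W = M := by
      ext x
      constructor
      · intro hx
        have hx' := superlatticeOf_le_invSMul hx
        obtain ⟨y, hy, hyx⟩ := (mem_superlatticeOf ⟨x, hx'⟩).1 hx
        have hyM : (y : V) ∈ M := hy
        have : residueHom p b (⟨x, hx'⟩ - y) = 0 := by rw [map_sub, hyx, sub_self]
        have := hLM ((residueHom_eq_zero_iff hp0 b _).1 this)
        have h2 := M.add_mem this hyM
        simpa using h2
      · intro hx
        exact (mem_superlatticeOf ⟨x, hMp hx⟩).2 ⟨⟨x, hMp hx⟩, hx, rfl⟩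
    refine ⟨AddSubgroup.toZModSubmodule p W, ?_, ?_⟩
    · have h1 := relIndex_superlatticeOf hp0 b W
      have h2 := hcard (AddSubgroup.toZModSubmodule p W)
      rw [AddSubgroup.toZModSubmodule_toAddSubgroup] at h2
      rw [hM, hidx, h2] at h1
      exact (Nat.pow_right_injective hp.out.two_le h1).symm
    · dsimp only
      rw [AddSubgroup.toZModSubmodule_toAddSubgroup, hM]
  · rintro ⟨W, hW, rfl⟩
    have hW : finrank (ZMod p) W = k := hW
    exact ⟨le_superlatticeOf hp0, superlatticeOf_le_invSMul, by
      rw [relIndex_superlatticeOf hp0, hcard, hW]⟩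

open Classical in
theorem ncard_setOf_mem_superlattices {p : ℕ} [hp : Fact p.Prime] (k : ℕ) (b : Basis (Fin n) ℤ L)
    {x : V} (hx : x ∈ invSMul p L) :
    ({M | M ∈ superlattices p k L ∧ x ∈ M}.ncard : ℤ) =
      if x ∈ L then Polynomial.aeval (p : ℤ) (gaussBinom n k)
      else Polynomial.aeval (p : ℤ) (gaussBinomThrough n k) := by
  have hp0 := hp.out.ne_zero
  have hV : finrank (ZMod p) (Fin n → ZMod p) = n := Module.finrank_fin_fun _
  have himage : {M | M ∈ superlattices p k L ∧ x ∈ M} =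
      (fun W : Submodule (ZMod p) (Fin n → ZMod p) => superlatticeOf p b W.toAddSubgroup) ''
        {W | finrank (ZMod p) W = k ∧ residueHom p b ⟨x, hx⟩ ∈ W} := by
    rw [superlattices_eq_image k b]
    ext M
    constructor
    · rintro ⟨⟨W, hW, rfl⟩, hxW⟩
      exact ⟨W, ⟨hW, (mem_superlatticeOf ⟨x, hx⟩).1 hxW⟩, rfl⟩
    · rintro ⟨W, ⟨hW, hxW⟩, rfl⟩
      exact ⟨⟨W, hW, rfl⟩, (mem_superlatticeOf ⟨x, hx⟩).2 hxW⟩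
  rw [himage, Set.ncard_image_of_injective]
  · split_ifs with h
    · rw [(residueHom_eq_zero_iff hp0 b ⟨x, hx⟩).2 h]
      simp only [Submodule.zero_mem, and_true]
      rw [ncard_setOf_finrank_eq hV, Nat.card_zmod]
    · rw [ncard_setOf_finrank_eq_and_mem hV
        (fun h0 => h ((residueHom_eq_zero_iff hp0 b ⟨x, hx⟩).1 h0)), Nat.card_zmod]
  · exact (superlatticeOf_injective hp0 b).comp Submodule.toAddSubgroup_injective

/-! ### The Hecke eigenvalue equation -/

theorem smul_inter_invSMul {p : ℕ} (hp : p ≠ 0) (P : Set V) (t : ℕ) :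
    (fun x : V => (p : ℤ) • x) '' ((t : ℝ) • P ∩ (invSMul p L : Set V)) =
      ((p * t : ℕ) : ℝ) • P ∩ (L : Set V) := by
  have hpR : (p : ℝ) ≠ 0 := by exact_mod_cast hp
  have hsmul : ∀ x : V, (p : ℤ) • x = (p : ℝ) • x := fun x => by
    rw [← Int.cast_smul_eq_zsmul ℝ, Int.cast_natCast]
  rw [Nat.cast_mul, mul_smul]
  ext y
  constructor
  · rintro ⟨x, ⟨hxP, hxL⟩, rfl⟩
    refine ⟨?_, hxL⟩
    dsimp only
    rw [hsmul]
    exact Set.smul_mem_smul_set hxP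
  · rintro ⟨⟨x, hx, rfl⟩, hyL⟩
    refine ⟨x, ⟨hx, mem_invSMul.2 ?_⟩, hsmul x⟩
    rw [hsmul]
    exact hyL

theorem finite_inter_of_isBounded [FiniteDimensional ℝ V] [DiscreteTopology L] {K : Set V}
    (hK : Bornology.IsBounded K) : (K ∩ (L : Set V)).Finite := by
  have : ProperSpace V := FiniteDimensional.proper ℝ V
  have : DiscreteTopology L.toAddSubgroup := ‹DiscreteTopology L›
  exact Metric.finite_isBounded_inter_isClosed DiscreteTopology.isDiscrete hK
    (AddSubgroup.isClosed_of_discrete (H := L.toAddSubgroup))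

theorem finite_inter_of_isBounded_of_le_invSMul [FiniteDimensional ℝ V] [DiscreteTopology L]
    {p : ℕ} (hp : p ≠ 0) {M : Submodule ℤ V} (hM : M ≤ invSMul p L) {K : Set V}
    (hK : Bornology.IsBounded K) : (K ∩ (M : Set V)).Finite := by
  refine Set.Finite.of_finite_image (f := fun x : V => (p : ℤ) • x)
    ((finite_inter_of_isBounded (L := L) (hK.smul₀ (p : ℝ))).subset ?_)
    (zsmul_injective_of_ne_zero hp).injOn
  rintro _ ⟨x, ⟨hxK, hxM⟩, rfl⟩
  refine ⟨⟨x, hxK, ?_⟩, hM hxM⟩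
  dsimp only
  rw [← Int.cast_smul_eq_zsmul ℝ, Int.cast_natCast]

theorem IsLatticePolytope.isEhrhartPolynomial {P : Set V} (hP : IsLatticePolytope L P)
    {M : Submodule ℤ V} (hLM : L ≤ M)
    (hM : ∀ K : Set V, Bornology.IsBounded K → (K ∩ M).Finite) :
    IsEhrhartPolynomial M P (ehrhartPolynomial M P) := by
  obtain ⟨⟨S, hS, rfl⟩, hspan⟩ := hP
  have hne : S.Nonempty := by
    rw [Finset.nonempty_iff_ne_empty]
    rintro rfl
    rw [Finset.coe_empty, convexHull_empty, AffineSubspace.span_empty] at hspan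
    exact bot_ne_top hspan
  obtain ⟨f, hf⟩ := exists_isEhrhartPolynomial hM hne fun s hs => hLM (hS hs)
  exact hf.ehrhartPolynomial

theorem IsLatticePolytope.isBounded {P : Set V} (hP : IsLatticePolytope L P) :
    Bornology.IsBounded P := by
  obtain ⟨⟨S, -, rfl⟩, -⟩ := hP
  exact isBounded_convexHull.2 S.finite_toSet.isBounded

/-- Summing over the superlattices `M` and exchanging the sums: each point of `tP ∩ p⁻¹L` is
counted with a multiplicity that depends only on whether it lies in `L`. -/
theorem heckeEhrhart_eq [FiniteDimensional ℝ V] [DiscreteTopology L] {p : ℕ} [hp : Fact p.Prime]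
    (k : ℕ) (b : Basis (Fin n) ℤ L) {P : Set V} (hP : IsLatticePolytope L P) :
    heckeEhrhart p k L P =
      Polynomial.C ((Polynomial.aeval (p : ℤ) (gaussBinomThrough n k) : ℤ) : ℚ) *
          (ehrhartPolynomial L P).comp (Polynomial.C (p : ℚ) * Polynomial.X) +
        Polynomial.C ((Polynomial.aeval (p : ℤ) (gaussBinom n k) -
          Polynomial.aeval (p : ℤ) (gaussBinomThrough n k) : ℤ) : ℚ) * ehrhartPolynomial L P := by
  classical
  have hp0 := hp.out.ne_zero
  set N₀ : ℤ := Polynomial.aeval (p : ℤ) (gaussBinom n k) with hN₀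
  set N₁ : ℤ := Polynomial.aeval (p : ℤ) (gaussBinomThrough n k) with hN₁
  have hfin : ∀ M ≤ invSMul p L, ∀ K : Set V, Bornology.IsBounded K → (K ∩ (M : Set V)).Finite :=
    fun M hM K hK => finite_inter_of_isBounded_of_le_invSMul hp0 hM hK
  have hE : IsEhrhartPolynomial L P (ehrhartPolynomial L P) :=
    hP.isEhrhartPolynomial le_rfl (hfin L (le_invSMul p L))
  refine Polynomial.eq_of_infinite_eval_eq _ _
    ((Set.infinite_range_of_injective (Nat.cast_injective (R := ℚ))).mono ?_)
  rintro _ ⟨t, rfl⟩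
  -- Both sides are compared at `t`, where they count lattice points.
  change Polynomial.eval (t : ℚ) _ = Polynomial.eval (t : ℚ) _
  have hXfin : ((t : ℝ) • P ∩ (invSMul p L : Set V)).Finite :=
    hfin _ le_rfl _ (hP.isBounded.smul₀ _)
  set X := hXfin.toFinset with hX
  have hcount : ∀ M ≤ invSMul p L,
      (((t : ℝ) • P ∩ (M : Set V)).ncard : ℤ) = (X.filter (· ∈ M)).card := by
    intro M hM
    rw [← Set.ncard_coe_finset, Finset.coe_filter]
    congr 2
    ext x
    simp only [hX, Set.Finite.mem_toFinset]
    exact ⟨fun h => ⟨⟨h.1, hM h.2⟩, h.2⟩, fun h => ⟨h.1.1, h.2⟩⟩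
  have hXcard : (((p * t : ℕ) : ℝ) • P ∩ (L : Set V)).ncard = X.card := by
    rw [← smul_inter_invSMul hp0, Set.ncard_image_of_injective _ (zsmul_injective_of_ne_zero hp0),
      Set.ncard_eq_toFinset_card _ hXfin]
  have hsum : ((∑ M ∈ (finite_superlattices p k L).toFinset,
      ((t : ℝ) • P ∩ (M : Set V)).ncard : ℕ) : ℤ) =
      N₁ * (((p * t : ℕ) : ℝ) • P ∩ (L : Set V)).ncard +
        (N₀ - N₁) * ((t : ℝ) • P ∩ (L : Set V)).ncard := by
    have hswap := Finset.sum_card_bipartiteAbove_eq_sum_card_bipartiteBelow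
      (fun (M : Submodule ℤ V) (x : V) => x ∈ M) (s := (finite_superlattices p k L).toFinset)
      (t := X)
    simp only [Finset.bipartiteAbove, Finset.bipartiteBelow] at hswap
    have h1 : ∀ x ∈ X, ((((finite_superlattices p k L).toFinset.filter (x ∈ ·)).card : ℕ) : ℤ) =
        N₁ + (N₀ - N₁) * if x ∈ L then 1 else 0 := by
      intro x hx
      have := ncard_setOf_mem_superlattices k b (hXfin.mem_toFinset.1 hx).2
      rw [← Set.ncard_coe_finset, Finset.coe_filter]
      simp only [Set.Finite.mem_toFinset]
      rw [this]
      split_ifs <;> ring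
    rw [hXcard, hcount L (le_invSMul p L), Nat.cast_sum,
      Finset.sum_congr rfl fun M hM =>
        hcount M ((finite_superlattices p k L).mem_toFinset.1 hM).2.1,
      ← Nat.cast_sum, hswap, Nat.cast_sum, Finset.sum_congr rfl h1, Finset.sum_add_distrib,
      ← Finset.mul_sum, Finset.sum_const, Finset.card_filter]
    push_cast
    rw [nsmul_eq_mul]
    ring
  have hsumQ := congrArg (Int.cast : ℤ → ℚ) hsum
  push_cast at hsumQ
  rw [heckeEhrhart, Polynomial.eval_finsetSum, Finset.sum_congr rfl fun M hM =>
    (hP.isEhrhartPolynomial ((finite_superlattices p k L).mem_toFinset.1 hM).1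
      (hfin M ((finite_superlattices p k L).mem_toFinset.1 hM).2.1)) t]
  have hEpt := hE (p * t)
  push_cast at hEpt
  simp only [Polynomial.eval_add, Polynomial.eval_mul, Polynomial.eval_C, Polynomial.eval_comp,
    Polynomial.eval_X, hEpt, hE t]
  push_cast
  exact hsumQ

theorem coeff_heckeEhrhart [FiniteDimensional ℝ V] [DiscreteTopology L] {p : ℕ} [hp : Fact p.Prime]
    (k : ℕ) (b : Basis (Fin n) ℤ L) {P : Set V} (hP : IsLatticePolytope L P)
    (U : Submodule (ZMod p) (Fin n → ZMod p)) :
    (heckeEhrhart p k L P).coeff (finrank (ZMod p) U) =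
      (nu k U : ℚ) * (ehrhartPolynomial L P).coeff (finrank (ZMod p) U) := by
  rw [heckeEhrhart_eq k b hP, Polynomial.coeff_add, Polynomial.coeff_C_mul, Polynomial.coeff_C_mul,
    Polynomial.comp_C_mul_X_coeff]
  have := congrArg (Int.cast : ℤ → ℚ) (nu_eq k U)
  push_cast at this
  rw [this]
  push_cast
  ring

end Superlattices

end HeckeEhrhart

end

theorem theorem1 (n k l : ℕ) (hk : k ≤ n) (hl : l ≤ n) :
    -- Hecke eigenvalue equation, for genuine Ehrhart polynomials
    (∀ (p : ℕ) [Fact p.Prime] (U : Submodule (ZMod p) (Fin n → ZMod p)),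
      Module.finrank (ZMod p) U = l →
      ∀ (V : Type*) [NormedAddCommGroup V] [NormedSpace ℝ V] [FiniteDimensional ℝ V]
        (L : Submodule ℤ V) [DiscreteTopology L] [IsZLattice ℝ L] (P : Set V),
      Module.finrank ℝ V = n → HeckeEhrhart.IsLatticePolytope L P →
        HeckeEhrhart.IsEhrhartPolynomial L P (HeckeEhrhart.ehrhartPolynomial L P) ∧
        (∀ M ∈ HeckeEhrhart.superlattices p k L,
          HeckeEhrhart.IsEhrhartPolynomial M P (HeckeEhrhart.ehrhartPolynomial M P)) ∧
        (HeckeEhrhart.heckeEhrhart p k L P).coeff l =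
          (HeckeEhrhart.nu k U : ℚ) * (HeckeEhrhart.ehrhartPolynomial L P).coeff l) ∧
    -- functional equation of the eigenvalues
    (∀ (p : ℕ) [Fact p.Prime] (U U' : Submodule (ZMod p) (Fin n → ZMod p)),
      Module.finrank (ZMod p) U = l → Module.finrank (ZMod p) U' = n - l →
        (HeckeEhrhart.nu k U : ℚ) / (HeckeEhrhart.nu (n - k) U' : ℚ) =
          (p : ℚ) ^ ((k : ℤ) + (l : ℤ) - (n : ℤ))) ∧
    -- one integer polynomial without negative coefficients, for all primes and all choices of `U`
    (∃ Φ : Polynomial ℤ, (∀ i ∈ Φ.support, 0 < Φ.coeff i) ∧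
      ∀ (p : ℕ) [Fact p.Prime] (U : Submodule (ZMod p) (Fin n → ZMod p)),
        Module.finrank (ZMod p) U = l → Φ.eval (p : ℤ) = (HeckeEhrhart.nu k U : ℤ)) := by
  refine ⟨?_, fun p _ U U' hU hU' => HeckeEhrhart.nu_div_nu hk hU hU', ?_⟩
  · intro p hp U hU V _ _ _ L _ _ P hV hP
    have hfin : ∀ M ≤ HeckeEhrhart.invSMul p L, ∀ K : Set V, Bornology.IsBounded K →
        (K ∩ (M : Set V)).Finite := fun M hM K hK =>
      HeckeEhrhart.finite_inter_of_isBounded_of_le_invSMul hp.out.ne_zero hM hK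
    refine ⟨hP.isEhrhartPolynomial le_rfl (hfin L (HeckeEhrhart.le_invSMul p L)),
      fun M hM => hP.isEhrhartPolynomial hM.1 (hfin M hM.2.1), ?_⟩
    have : ProperSpace V := FiniteDimensional.proper ℝ V
    have : Module.Free ℤ L := ZLattice.module_free ℝ L
    have : Module.Finite ℤ L := ZLattice.module_finite ℝ L
    subst hU
    exact HeckeEhrhart.coeff_heckeEhrhart k
      (Module.finBasisOfFinrankEq ℤ L ((ZLattice.rank ℝ L).trans hV)) hP U
  · refine ⟨(HeckeEhrhart.nuPolynomial n k l).map (Nat.castRingHom ℤ), fun i hi => ?_,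
      fun p _ U hU => ?_⟩
    · rw [Polynomial.mem_support_iff, Polynomial.coeff_map] at hi
      rw [Polynomial.coeff_map]
      exact lt_of_le_of_ne (Int.natCast_nonneg _) (Ne.symm hi)
    · rw [← HeckeEhrhart.aeval_nuPolynomial, hU, Polynomial.eval_map, Polynomial.aeval_def]
      rfl
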